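/- Let $f\in C^1(\mathbb R)$ satisfy $f'(u)>\tfrac14$ and $|f'(u)|<1$ for all $u\in\mathbb R$. For $g\in C^1(\mathbb R)$ consider the strictly hyperbolic triangular system $u_t+f(u)_x=0$, $v_t+g(u)_x=0$ and the Lax–Friedrichs scheme with $\Delta x=\Delta t$. A discrete shock profile (DSP) of speed $\lambda$ connecting $(u_-,v_-)$ to $(u_+,v_+)$ is a function $\Psi=(U,V):\mathbb R\to\mathbb R^2$ of finite total variation, with limits $(u_\mp,v_\mp)$ at $\mp\infty$, such that for all $x\in\mathbb R$ $$U(x-\lambda)=\frac{U(x+1)+U(x-1)}2-\frac{f(U(x+1))-f(U(x-1))}2,\qquad V(x-\lambda)=\frac{V(x+1)+V(x-1)}2-\frac{g(U(x+1))-g(U(x-1))}2 .$$ A scalar DSP is a strictly monotone solution $U$ of the first equation with limits $u_\mp$ at $\mp\infty$. **Theorem.** Discrete shock profiles for the Lax–Friedrichs scheme for such systems do not depend continuously in BV on their speed. Precisely, let $\lambda=\tfrac12$, $\lambda_k=\frac{k}{2k+1}$ and $\varepsilon_k=\lambda_k-\lambda=-\frac1{4k+2}$. Let $u_-\neq u_+$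 be the end states of a shock of speed $\tfrac12$ for $u_t+f(u)_x=0$, that is, $f(u_+)-f(u_-)=\tfrac12(u_+-u_-)$ and $\big(f(u)-f(u_-)-\tfrac12(u-u_-)\big)(u_+-u_-)>0$ for all $u$ strictly between $u_-$ and $u_+$ (strict Oleinik condition), and let $u_0$ lie strictly between $u_-$ and $u_+$. Then there are states $u_\pm^k\to u_\pm$, a constant $L$, a scalar DSP $U$ of speed $\tfrac12$ connecting $u_-$ to $u_+$ and, for all sufficiently large even $k$, scalar DSPs $U_k$ of speed $\lambda_k$ connecting $u_-^k$ to $u_+^k$, all Lipschitz with constant $L$ and with $U(0)=U_k(0)=u_0$, and there is $\rho>0$, such that the following holds for every non-constant monotone (nondecreasing or nonincreasing) $g\in C^1(\mathbb R)$ with $g'=0$ outside $U([-\rho,\rho])$ (so that $\psi=(g\circ U)'$ has one sign and is supported in $[-\rho,\rho]$). There are functions $V$ and $V_k$ such that $\Psi=(U,V)$ is a DSP of speed $\tfrac12$ connecting $\big(u_-,2(g(u_-)-g(u_+))\big)$ to $(u_+,0)$ and, for all sufficiently large even $k$, $\Psi_k=(U_k,V_k)$ is a DSP of speed $\lambda_k$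 connecting $\big(u_-^k,\lambda_k^{-1}(g(u_-^k)-g(u_+^k))\big)$ to $(u_+^k,0)$, and: 1. there is $m>0$ with $\mathrm{TV}(\Psi_k-\Psi)\ge m$ for all sufficiently large even $k$; 2. for every $\delta\in(0,\tfrac12)$ there are constants $0<c<C$ and $m>0$ such that, for all sufficiently large even $k$, the total variation of $V_k-V$ on the interval $\big[-C|\varepsilon_k|^{-2/(1+2\delta)},\,-c|\varepsilon_k|^{-2/(1+2\delta)}\big]$ is at least $m$. -/

import Mathlib

open Filter Topology

/-- The speeds `λ_k = k / (2k + 1)`. -/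
noncomputable def speed (k : ℕ) : ℝ := (k : ℝ) / (2 * (k : ℝ) + 1)

/-- The distance `|ε_k|` of `λ_k` from the limiting speed `λ = 1/2`. -/
noncomputable def speedGap (k : ℕ) : ℝ := |speed k - 1 / 2|

/-- `(uL, uR)` is a nontrivial shock of speed `s` for `u_t + f(u)_x = 0`: the Rankine–Hugoniot
relation and the strict Oleinik condition, which says that the graph of `f` lies strictly below
(if `uR < uL`) or strictly above (if `uL < uR`) its chord between the two states. -/
structure IsStrictShock (f : ℝ → ℝ) (s uL uR : ℝ) : Prop where
  ne : uL ≠ uR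
  rankineHugoniot : f uR - f uL = s * (uR - uL)
  oleinik : ∀ u ∈ Set.uIoo uL uR, 0 < (f u - f uL - s * (u - uL)) * (uR - uL)

/-- The travelling wave equation of speed `lam` of the Lax–Friedrichs scheme with `Δx = Δt`
for one component `w` with flux values `F(x)`. -/
def LaxFriedrichsWave (lam : ℝ) (w F : ℝ → ℝ) : Prop :=
  ∀ x : ℝ, w (x - lam) = (w (x + 1) + w (x - 1)) / 2 - (F (x + 1) - F (x - 1)) / 2

/-- `U` is a discrete shock profile of speed `lam` for the Lax–Friedrichs scheme for the scalar law
`u_t + f(u)_x = 0`, connecting the left state `uL` to the right state `uR`. -/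
structure IsScalarProfile (f : ℝ → ℝ) (lam uL uR : ℝ) (U : ℝ → ℝ) : Prop where
  wave : LaxFriedrichsWave lam U (fun x => f (U x))
  left : Tendsto U atBot (𝓝 uL)
  right : Tendsto U atTop (𝓝 uR)
  strict : StrictMono U ∨ StrictAnti U

/-- The pair `(U, V)` is a discrete shock profile of speed `lam` for the Lax–Friedrichs scheme for
the triangular system `u_t + f(u)_x = 0`, `v_t + g(u)_x = 0`, connecting the state `left` to the state `right`,
and it has finite total variation on the real line. -/
structure IsSystemProfile (f g : ℝ → ℝ) (lam : ℝ) (left right : ℝ × ℝ) (Ψ : ℝ → ℝ × ℝ) :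
    Prop where
  wave_fst : LaxFriedrichsWave lam (fun x => (Ψ x).1) (fun x => f (Ψ x).1)
  wave_snd : LaxFriedrichsWave lam (fun x => (Ψ x).2) (fun x => g (Ψ x).1)
  tendsto_left : Tendsto Ψ atBot (𝓝 left)
  tendsto_right : Tendsto Ψ atTop (𝓝 right)
  bv : BoundedVariationOn Ψ Set.univ

/-- The downstream interval `[-C |ε_k|^{-2/(1+2δ)}, -c |ε_k|^{-2/(1+2δ)}]`. -/
noncomputable def downstream (δ c C : ℝ) (k : ℕ) : Set ℝ :=
  Set.Icc (-(C * speedGap k ^ (-2 / (1 + 2 * δ)))) (-(c * speedGap k ^ (-2 / (1 + 2 * δ))))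

/-! The scalar component is treated by the theory of monotone schemes, the second component as a
linear problem with a resonance.

Scalar profiles. In the form `U x = plusFlux f (U (x - (1 - s))) + minusFlux f (U (x + (1 + s)))`
the wave equation has two increasing terms. A least fixed point gives monotone solutions on `[0,
K]`. The conserved flux `waveFlux` and the Oleinik condition keep their transition away from both
ends, so `K → ∞` gives waves on the line (`exists_isWave`). Increments summed over `x + 2ℤ` are also
invariant under `x ↦ x + (1 + s)`. For irrational `s` these translations are dense, hence the wave
has Lipschitz constant `(uR - uL) / 2` (`IsWave.latticeMass_le`). The bound survives limits in `s`,
so such waves exist at rational speeds too, where they are strictly monotone. By compactness the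
profiles of speed `λ_k` cross a fixed neighbourhood of `u₀` within `|x| ≤ 1/100`
(`exists_uniform_gap`), and this decides `ρ`.

Second component. Given `U`, the equation for `V` is linear with source `g ∘ U`. For `s = 1 - l / q`
it lives on cosets of `(1/q)ℤ` with symbol `z^(2q) - 2 z^l + 1`. If `2q` and `l` are coprime, its
only zero on the unit circle is a simple one at `1`, and inversion in `ℓ¹` gives `V`. Evenness of
`k` provides the coprimality.

Lower bound. The mode `exp (iζx)` solves the homogeneous equation if `exp (iζ(1+s)) + exp (-iζ(1-s))
= 2`. At `s = 1/2` this holds for `ζ = 4π`. At `s = 1/2 + ε` the root moves by `O(ε)`, its imaginary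
part is only `O(ε²)`, and the source now excites the mode with strength of order `ε`. Testing
against `exp (-iζx)` (`oscillation_lower_bound`) shows that `V_k` oscillates by at least a constant
times `|ε|` on every window of length 2, up to distances of order `ε^(-2)` downstream. On `[-2T,
-T]` this sums to order `T|ε|`. The choice `T = |ε|^(-2/(1+2δ))` has `T ε² ≤ 1` and `T|ε| → ∞` for
`0 < δ < 1/2`. So the variation of `V_k` there is even unbounded, while that of `V` is finite; both
conclusions follow. -/

/-! ### Monotone splitting of the scheme and shock conditions -/

/-- The flux carried to the right by the Lax–Friedrichs scheme. -/
noncomputable def plusFlux (f : ℝ → ℝ) (u : ℝ) : ℝ := (u + f u) / 2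

/-- The flux carried to the left by the Lax–Friedrichs scheme. -/
noncomputable def minusFlux (f : ℝ → ℝ) (u : ℝ) : ℝ := (u - f u) / 2

lemma plusFlux_add_minusFlux (f : ℝ → ℝ) (u : ℝ) : plusFlux f u + minusFlux f u = u := by
  unfold plusFlux minusFlux; ring

/-- The Lax–Friedrichs scheme for the flux `f` is strictly monotone. -/
structure IsMonotoneFlux (f : ℝ → ℝ) : Prop where
  cont : Continuous f
  plus : StrictMono (plusFlux f)
  minus : StrictMono (minusFlux f)

lemma IsMonotoneFlux.continuous_plus {f : ℝ → ℝ} (hf : IsMonotoneFlux f) :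
    Continuous (plusFlux f) := by
  have := hf.cont
  unfold plusFlux; fun_prop

lemma IsMonotoneFlux.continuous_minus {f : ℝ → ℝ} (hf : IsMonotoneFlux f) :
    Continuous (minusFlux f) := by
  have := hf.cont
  unfold minusFlux; fun_prop

lemma isMonotoneFlux_of_deriv {f : ℝ → ℝ} (hf : ContDiff ℝ 1 f) (h : ∀ u, |deriv f u| < 1) :
    IsMonotoneFlux f := by
  have hd : Differentiable ℝ f := hf.differentiable one_ne_zero
  refine ⟨hf.continuous, strictMono_of_deriv_pos fun u => ?_, strictMono_of_deriv_pos fun u => ?_⟩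
  · have : HasDerivAt (plusFlux f) ((1 + deriv f u) / 2) u :=
      ((hasDerivAt_id u).add (hd u).hasDerivAt).div_const 2
    rw [this.deriv]; linarith [(abs_lt.1 (h u)).1]
  · have : HasDerivAt (minusFlux f) ((1 - deriv f u) / 2) u :=
      ((hasDerivAt_id u).sub (hd u).hasDerivAt).div_const 2
    rw [this.deriv]; linarith [(abs_lt.1 (h u)).2]

lemma plusFlux_comp_neg (f : ℝ → ℝ) (u : ℝ) :
    plusFlux (fun v => f (-v)) u = -minusFlux f (-u) := by
  unfold plusFlux minusFlux; ring

lemma minusFlux_comp_neg (f : ℝ → ℝ) (u : ℝ) :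
    minusFlux (fun v => f (-v)) u = -plusFlux f (-u) := by
  unfold plusFlux minusFlux; ring

lemma IsMonotoneFlux.comp_neg {f : ℝ → ℝ} (hf : IsMonotoneFlux f) :
    IsMonotoneFlux (fun v => f (-v)) := by
  refine ⟨hf.cont.comp continuous_neg, fun u v h => ?_, fun u v h => ?_⟩
  · rw [plusFlux_comp_neg, plusFlux_comp_neg]
    exact neg_lt_neg (hf.minus (neg_lt_neg h))
  · rw [minusFlux_comp_neg, minusFlux_comp_neg]
    exact neg_lt_neg (hf.plus (neg_lt_neg h))

/-- The travelling wave equation of speed `s` at the point `x`. -/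
def WaveAt (f : ℝ → ℝ) (s : ℝ) (U : ℝ → ℝ) (x : ℝ) : Prop :=
  U x = plusFlux f (U (x - (1 - s))) + minusFlux f (U (x + (1 + s)))

/-- The graph of `f` lies strictly above its chord of slope `s` over `(uL, uR)`. -/
structure IncreasingShock (f : ℝ → ℝ) (s uL uR : ℝ) : Prop where
  lt : uL < uR
  rankineHugoniot : f uR - s * uR = f uL - s * uL
  oleinik : ∀ u ∈ Set.Ioo uL uR, f uL - s * uL < f u - s * u

lemma IncreasingShock.comp_neg {f : ℝ → ℝ} {s uL uR : ℝ} (h : IncreasingShock f s uL uR) :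
    IncreasingShock (fun v => f (-v)) (-s) (-uR) (-uL) := by
  refine ⟨neg_lt_neg h.lt, ?_, fun u hu => ?_⟩
  · have := h.rankineHugoniot
    simp only [neg_neg]; linarith
  · have h1 := h.oleinik (-u) ⟨by linarith [hu.2], by linarith [hu.1]⟩
    have := h.rankineHugoniot
    simp only [neg_neg]; linarith

lemma IncreasingShock.eq_or_eq {f : ℝ → ℝ} {s uL uR w : ℝ} (h : IncreasingShock f s uL uR)
    (hL : uL ≤ w) (hR : w ≤ uR) (hw : f w - s * w ≤ f uL - s * uL) : w = uL ∨ w = uR := by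
  by_contra! hne
  exact absurd (h.oleinik w ⟨lt_of_le_of_ne hL hne.1.symm, lt_of_le_of_ne hR hne.2⟩) (not_lt.2 hw)

/-! ### Solutions on bounded intervals -/

/-- A monotone solution of the travelling wave equation on `[0, K]`, extended by constants. -/
structure IsDomainSolution (f : ℝ → ℝ) (s uL uR K : ℝ) (U : ℝ → ℝ) : Prop where
  mono : Monotone U
  lower : ∀ x, uL ≤ U x
  upper : ∀ x, U x ≤ uR
  left : ∀ x < 0, U x = uL
  right : ∀ x, K < x → U x = uR
  wave : ∀ x, 0 ≤ x → x ≤ K → WaveAt f s U x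

/-- Knaster–Tarski: the right-hand side of the wave equation, with constant values outside `[0, K]`,
is an order-preserving map of the complete lattice of functions into `[uL, uR]`. -/
lemma exists_domainSolution {f : ℝ → ℝ} (hf : IsMonotoneFlux f) {uL uR : ℝ} (h : uL ≤ uR)
    (s : ℝ) {K : ℝ} (hK : 0 ≤ K) : ∃ U, IsDomainSolution f s uL uR K U := by
  have : Fact (uL ≤ uR) := ⟨h⟩
  have hmem : ∀ v w : Set.Icc uL uR, plusFlux f v + minusFlux f w ∈ Set.Icc uL uR := by
    intro v w
    have h1 := hf.plus.monotone v.2.1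
    have h2 := hf.plus.monotone v.2.2
    have h3 := hf.minus.monotone w.2.1
    have h4 := hf.minus.monotone w.2.2
    have h5 := plusFlux_add_minusFlux f uL
    have h6 := plusFlux_add_minusFlux f uR
    constructor <;> linarith
  let T : (ℝ → Set.Icc uL uR) →o (ℝ → Set.Icc uL uR) :=
    { toFun := fun U x => if x < 0 then ⟨uL, le_rfl, h⟩ else if K < x then ⟨uR, h, le_rfl⟩ else
        ⟨_, hmem (U (x - (1 - s))) (U (x + (1 + s)))⟩
      monotone' := by
        intro U V hUV x
        simp only
        split_ifs
        · exact le_rfl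
        · exact le_rfl
        · exact Subtype.mk_le_mk.2 (add_le_add (hf.plus.monotone (hUV _))
            (hf.minus.monotone (hUV _))) }
  have hT : ∀ (U : ℝ → Set.Icc uL uR) x, T U x = if x < 0 then ⟨uL, le_rfl, h⟩ else
      if K < x then ⟨uR, h, le_rfl⟩ else ⟨_, hmem (U (x - (1 - s))) (U (x + (1 + s)))⟩ :=
    fun U x => rfl
  set W := T.lfp with hW
  have hfix : ∀ x, W x = T W x := fun x => congrFun T.map_lfp.symm x
  have hmono : Monotone W := by
    intro x y hxy
    -- Monotonicity comes from leastness: a left translate of the least fixed point is a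
    -- supersolution of the same problem.
    have : W ≤ fun z => W (z + (y - x)) := by
      refine T.lfp_le fun z => ?_
      rw [hT]
      split_ifs with h1 h2
      · exact Subtype.coe_le_coe.1 (W _).2.1
      · rw [hfix (z + (y - x)), hT, if_neg (by linarith), if_pos (by linarith)]
      · rw [hfix (z + (y - x)), hT, if_neg (by linarith)]
        split_ifs with h3
        · exact Subtype.coe_le_coe.1 (hmem _ _).2
        · have e1 : z + (y - x) - (1 - s) = z - (1 - s) + (y - x) := by ring
          have e2 : z + (y - x) + (1 + s) = z + (1 + s) + (y - x) := by ring
          exact (Subtype.ext (by simp only [e1, e2])).le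
    have := this x
    simpa using this
  refine ⟨fun x => W x, fun x y hxy => hmono hxy, fun x => (W x).2.1, fun x => (W x).2.2,
    fun x hx => ?_, fun x hx => ?_, fun x h0 hx => ?_⟩
  · simp only [hfix x, hT, if_pos hx]
  · simp only [hfix x, hT, if_neg (not_lt.2 (hK.trans hx.le)), if_pos hx]
  · simp only [WaveAt]
    rw [hfix x, hT, if_neg (not_lt.2 h0), if_neg (not_lt.2 hx)]

/-! ### The conserved flux and rigidity on a half-line -/

lemma Monotone.le_integral_and_integral_le {G : ℝ → ℝ} (hG : Monotone G) {x y : ℝ} (h : x ≤ y) :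
    (y - x) * G x ≤ ∫ t in x..y, G t ∧ ∫ t in x..y, G t ≤ (y - x) * G y := by
  have h1 := intervalIntegral.integral_mono_on h intervalIntegrable_const
    (hG.intervalIntegrable (μ := MeasureTheory.volume)) fun t ht => hG ht.1
  have h2 := intervalIntegral.integral_mono_on h
    (hG.intervalIntegrable (μ := MeasureTheory.volume)) intervalIntegrable_const fun t ht => hG ht.2
  simp only [intervalIntegral.integral_const, smul_eq_mul] at h1 h2
  exact ⟨h1, h2⟩

/-- The flux of `U` through the moving point `x`. -/
noncomputable def waveFlux (f : ℝ → ℝ) (s : ℝ) (U : ℝ → ℝ) (x : ℝ) : ℝ :=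
  (∫ y in (x - (1 - s))..x, plusFlux f (U y)) - ∫ y in x..(x + (1 + s)), minusFlux f (U y)

/-- Integrate the wave equation over `[x, y]`, write `U` on the left as the sum of its two fluxes,
and move the translations into the limits of integration. -/
lemma waveFlux_eq_of_waveAt {f : ℝ → ℝ} (hf : IsMonotoneFlux f) {s : ℝ} {U : ℝ → ℝ}
    (hU : Monotone U) {x y : ℝ} (hxy : x ≤ y) (hw : ∀ z, x ≤ z → z ≤ y → WaveAt f s U z) :
    waveFlux f s U x = waveFlux f s U y := by
  have hp : Monotone fun z => plusFlux f (U z) := hf.plus.monotone.comp hU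
  have hm : Monotone fun z => minusFlux f (U z) := hf.minus.monotone.comp hU
  have ip : ∀ a b, IntervalIntegrable (fun z => plusFlux f (U z)) MeasureTheory.volume a b :=
    fun a b => hp.intervalIntegrable
  have im : ∀ a b, IntervalIntegrable (fun z => minusFlux f (U z)) MeasureTheory.volume a b :=
    fun a b => hm.intervalIntegrable
  have e1 : (∫ z in x..y, plusFlux f (U (z - (1 - s)))) =
      ∫ z in (x - (1 - s))..(y - (1 - s)), plusFlux f (U z) :=
    intervalIntegral.integral_comp_sub_right (fun z => plusFlux f (U z)) _
  have e2 : (∫ z in x..y, minusFlux f (U (z + (1 + s)))) =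
      ∫ z in (x + (1 + s))..(y + (1 + s)), minusFlux f (U z) :=
    intervalIntegral.integral_comp_add_right (fun z => minusFlux f (U z)) _
  have e3 : (∫ z in x..y, (plusFlux f (U z) + minusFlux f (U z))) =
      ∫ z in x..y, (plusFlux f (U (z - (1 - s))) + minusFlux f (U (z + (1 + s)))) := by
    refine intervalIntegral.integral_congr fun z hz => ?_
    rw [Set.uIcc_of_le hxy] at hz
    have := hw z hz.1 hz.2
    simp only [plusFlux_add_minusFlux]
    exact this
  have hp' : Monotone fun z => plusFlux f (U (z - (1 - s))) :=
    hp.comp fun a b h => sub_le_sub_right h _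
  have hm' : Monotone fun z => minusFlux f (U (z + (1 + s))) :=
    hm.comp fun a b h => add_le_add_left h _
  rw [intervalIntegral.integral_add (ip _ _) (im _ _),
    intervalIntegral.integral_add hp'.intervalIntegrable hm'.intervalIntegrable, e1, e2] at e3
  have c1 := intervalIntegral.integral_add_adjacent_intervals (ip (x - (1 - s)) x) (ip x y)
  have c2 := intervalIntegral.integral_add_adjacent_intervals (ip (x - (1 - s)) (y - (1 - s)))
    (ip (y - (1 - s)) y)
  have c3 := intervalIntegral.integral_add_adjacent_intervals (im x y) (im y (y + (1 + s)))
  have c4 := intervalIntegral.integral_add_adjacent_intervals (im x (x + (1 + s)))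
    (im (x + (1 + s)) (y + (1 + s)))
  unfold waveFlux
  linarith

lemma flux_const_eq (f : ℝ → ℝ) (s u : ℝ) :
    (1 - s) * plusFlux f u - (1 + s) * minusFlux f u = f u - s * u := by
  unfold plusFlux minusFlux; ring

lemma le_waveFlux {f : ℝ → ℝ} (hf : IsMonotoneFlux f) {s : ℝ} (hs : |s| < 1) {U : ℝ → ℝ}
    (hU : Monotone U) (x : ℝ) :
    (1 - s) * plusFlux f (U (x - (1 - s))) - (1 + s) * minusFlux f (U (x + (1 + s)))
      ≤ waveFlux f s U x := by
  obtain ⟨h1, h2⟩ := abs_lt.1 hs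
  have hp := ((hf.plus.monotone.comp hU).le_integral_and_integral_le
    (show x - (1 - s) ≤ x by linarith)).1
  have hm := ((hf.minus.monotone.comp hU).le_integral_and_integral_le
    (show x ≤ x + (1 + s) by linarith)).2
  simp only [Function.comp_apply, sub_sub_cancel, add_sub_cancel_left] at hp hm
  unfold waveFlux
  linarith

lemma waveFlux_le {f : ℝ → ℝ} (hf : IsMonotoneFlux f) {s : ℝ} (hs : |s| < 1) {U : ℝ → ℝ}
    (hU : Monotone U) (x : ℝ) : waveFlux f s U x ≤ f (U x) - s * U x := by
  obtain ⟨h1, h2⟩ := abs_lt.1 hs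
  have hp := ((hf.plus.monotone.comp hU).le_integral_and_integral_le
    (show x - (1 - s) ≤ x by linarith)).2
  have hm := ((hf.minus.monotone.comp hU).le_integral_and_integral_le
    (show x ≤ x + (1 + s) by linarith)).1
  simp only [Function.comp_apply, sub_sub_cancel, add_sub_cancel_left] at hp hm
  rw [← flux_const_eq]
  unfold waveFlux
  linarith

/-- Left of `0` the plus flux is that of `uL`, while the minus flux beyond `y` is at least its value
at `y`. The defect term measures how far `U` has left `uL` at `y`. -/
lemma waveFlux_zero_le {f : ℝ → ℝ} (hf : IsMonotoneFlux f) {s : ℝ} (hs : |s| < 1) {U : ℝ → ℝ}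
    (hU : Monotone U) {uL y : ℝ} (hL : ∀ x, uL ≤ U x) (h0 : ∀ x < 0, U x = uL) (hy : 0 ≤ y)
    (hys : y ≤ 1 + s) :
    waveFlux f s U 0 ≤
      f uL - s * uL - (1 + s - y) * (minusFlux f (U y) - minusFlux f uL) := by
  obtain ⟨h1, h2⟩ := abs_lt.1 hs
  have hp : (∫ t in (0 - (1 - s))..0, plusFlux f (U t)) = (1 - s) * plusFlux f uL := by
    rw [intervalIntegral.integral_congr_ae' (g := fun _ => plusFlux f uL)]
    · simp
    · have : ∀ᵐ t : ℝ, t ≠ 0 := by simp [MeasureTheory.ae_iff]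
      filter_upwards [this] with t ht ht'
      rw [h0 t (lt_of_le_of_ne ht'.2 ht)]
    · exact Filter.Eventually.of_forall fun t ht => absurd (ht.1.trans_le ht.2) (by linarith)
  have hm : Monotone fun z => minusFlux f (U z) := hf.minus.monotone.comp hU
  have im : ∀ a b, IntervalIntegrable (fun z => minusFlux f (U z)) MeasureTheory.volume a b :=
    fun a b => hm.intervalIntegrable
  have m1 := (hm.le_integral_and_integral_le hy).1
  have m2 := (hm.le_integral_and_integral_le hys).1
  have m3 := hf.minus.monotone (hL 0)
  have m4 := mul_le_mul_of_nonneg_left m3 hy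
  have c := intervalIntegral.integral_add_adjacent_intervals (im 0 y) (im y (1 + s))
  rw [← flux_const_eq]
  unfold waveFlux
  rw [hp, zero_add, ← c]
  simp only [sub_zero] at m1
  linarith

/-- The flux equals `f w - s * w` for the limit `w` at infinity and, by the boundary value, is at
most that of `uL`. The Oleinik condition turns this into equality, so the boundary defect vanishes.
-/
lemma eq_const_of_waveAt_halfLine {f : ℝ → ℝ} (hf : IsMonotoneFlux f) {s : ℝ} (hs : |s| < 1)
    {uL uR : ℝ} (hsh : IncreasingShock f s uL uR) {W : ℝ → ℝ} (hW : Monotone W)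
    (hL : ∀ x, uL ≤ W x) (hR : ∀ x, W x ≤ uR) (h0 : ∀ x < 0, W x = uL)
    (hw : ∀ x, 0 ≤ x → WaveAt f s W x) (x : ℝ) : W x = uL := by
  obtain ⟨h1, h2⟩ := abs_lt.1 hs
  obtain ⟨w, hlim⟩ : ∃ w, Tendsto W atTop (𝓝 w) :=
    ⟨_, tendsto_atTop_ciSup hW ⟨uR, by rintro _ ⟨x, rfl⟩; exact hR x⟩⟩
  have hwL : uL ≤ w := ge_of_tendsto' hlim hL
  have hwR : w ≤ uR := le_of_tendsto' hlim hR
  have hc : Continuous fun u => f u - s * u := hf.cont.sub (continuous_const.mul continuous_id)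
  have hQ : ∀ y, 0 ≤ y → waveFlux f s W y = waveFlux f s W 0 := fun y hy =>
    (waveFlux_eq_of_waveAt hf hW hy fun z hz _ => hw z hz).symm
  have hge : waveFlux f s W 0 ≤ f w - s * w := by
    refine ge_of_tendsto ((hc.tendsto w).comp hlim) ?_
    filter_upwards [eventually_ge_atTop 0] with y hy
    rw [← hQ y hy]
    exact waveFlux_le hf hs hW y
  have hle : f w - s * w ≤ waveFlux f s W 0 := by
    have t1 : Tendsto (fun y => W (y - (1 - s))) atTop (𝓝 w) :=
      hlim.comp (tendsto_atTop_add_const_right _ _ tendsto_id)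
    have t2 : Tendsto (fun y => W (y + (1 + s))) atTop (𝓝 w) :=
      hlim.comp (tendsto_atTop_add_const_right _ _ tendsto_id)
    have t3 := (((hf.continuous_plus.tendsto w).comp t1).const_mul (1 - s)).sub
      (((hf.continuous_minus.tendsto w).comp t2).const_mul (1 + s))
    rw [flux_const_eq] at t3
    refine le_of_tendsto t3 ?_
    filter_upwards [eventually_ge_atTop 0] with y hy
    rw [← hQ y hy]
    exact le_waveFlux hf hs hW y
  have hφ : f uL - s * uL ≤ f w - s * w := by
    have hz := waveFlux_zero_le hf hs hW hL h0 le_rfl (by linarith : (0:ℝ) ≤ 1 + s)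
    have := hf.minus.monotone (hL 0)
    have h3 : f w - s * w ≤ f uL - s * uL := by nlinarith
    rcases hsh.eq_or_eq hwL hwR h3 with h | h <;> rw [h]
    exact hsh.rankineHugoniot.ge
  -- With equal fluxes the defect in `waveFlux_zero_le` is zero, and `minusFlux` is strictly
  -- increasing.
  have hbase : ∀ y < 1 + s, W y = uL := by
    intro y hy
    rcases lt_or_ge y 0 with hneg | hpos
    · exact h0 y hneg
    · have hz := waveFlux_zero_le hf hs hW hL h0 hpos hy.le
      refine le_antisymm (hf.minus.le_iff_le.1 ?_) (hL y)
      have : (1 + s - y) * (minusFlux f (W y) - minusFlux f uL) ≤ 0 := by linarith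
      nlinarith
  -- The wave equation at `y - (1 + s)` determines the minus flux at `y` from values already known
  -- to be `uL`.
  have hstep : ∀ n : ℕ, ∀ y < (n + 1) * (1 + s), W y = uL := by
    intro n
    induction n with
    | zero => simpa using hbase
    | succ n ih =>
      intro y hy
      push_cast at hy
      rcases lt_or_ge y (1 + s) with h | h
      · exact hbase y h
      · have e := hw (y - (1 + s)) (by linarith)
        have e1 := ih (y - (1 + s)) (by nlinarith)
        have e2 := ih (y - (1 + s) - (1 - s)) (by nlinarith)
        rw [WaveAt, sub_add_cancel, e1, e2] at e
        exact hf.minus.injective (by linarith [plusFlux_add_minusFlux f uL])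
  obtain ⟨n, hn⟩ := exists_nat_gt (x / (1 + s))
  refine hstep n x ?_
  rw [div_lt_iff₀ (by linarith)] at hn
  nlinarith

/-! ### Waves on the whole line -/

/-- Reversing both `x` and `u` exchanges the two fluxes and keeps solutions increasing, so
statements about the left end also serve the right end. -/
lemma IsDomainSolution.reflect {f : ℝ → ℝ} {s uL uR K : ℝ} {U : ℝ → ℝ}
    (h : IsDomainSolution f s uL uR K U) :
    IsDomainSolution (fun v => f (-v)) (-s) (-uR) (-uL) K (fun x => -U (K - x)) := by
  refine ⟨fun x y hxy => neg_le_neg (h.mono (by linarith)), fun x => neg_le_neg (h.upper _),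
    fun x => neg_le_neg (h.lower _), fun x hx => by rw [h.right _ (by linarith)],
    fun x hx => by rw [h.left _ (by linarith)], fun x h0 hK => ?_⟩
  have := h.wave (K - x) (by linarith) (by linarith)
  unfold WaveAt at this ⊢
  change -U (K - x) = _
  rw [plusFlux_comp_neg, minusFlux_comp_neg, neg_neg, neg_neg, this,
    show K - (x - (1 - -s)) = K - x + (1 + s) by ring,
    show K - (x + (1 + -s)) = K - x - (1 - s) by ring]
  ring

lemma Ultrafilter.exists_tendsto_of_eventually_mem_Icc {ι : Type*} (𝒰 : Ultrafilter ι) {F : ι → ℝ}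
    {a b : ℝ} (h : ∀ᶠ i in (𝒰 : Filter ι), F i ∈ Set.Icc a b) :
    ∃ w, Tendsto F (𝒰 : Filter ι) (𝓝 w) := by
  obtain ⟨w, -, hw⟩ := isCompact_Icc.ultrafilter_le_nhds (𝒰.map F) (le_principal_iff.2 h)
  exact ⟨w, hw⟩

/-- If the crossings of `u₀` stayed bounded, an ultralimit would solve the half-line problem and
reach `u₀`, against `eq_const_of_waveAt_halfLine`. -/
lemma tendsto_crossing_atTop {ι : Type*} {𝒰 : Ultrafilter ι} {f : ℝ → ℝ} (hf : IsMonotoneFlux f)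
    {s : ℝ} (hs : |s| < 1) {uL uR u₀ : ℝ} (hsh : IncreasingShock f s uL uR) (h₀ : uL < u₀)
    {K c : ι → ℝ} {U : ι → ℝ → ℝ} (hK : Tendsto K 𝒰 atTop)
    (hU : ∀ i, IsDomainSolution f s uL uR (K i) (U i)) (hc : ∀ i x, c i < x → u₀ ≤ U i x) :
    Tendsto c 𝒰 atTop := by
  refine tendsto_atTop.2 fun C => ?_
  by_contra hC
  have hC' : ∀ᶠ i in (𝒰 : Filter ι), c i < C := by
    simpa using Ultrafilter.eventually_not.2 hC
  have hlim : ∀ x, ∃ w, Tendsto (fun i => U i x) 𝒰 (𝓝 w) := fun x =>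
    𝒰.exists_tendsto_of_eventually_mem_Icc
      (Eventually.of_forall fun i => ⟨(hU i).lower x, (hU i).upper x⟩)
  choose W hW using hlim
  have hconst := eq_const_of_waveAt_halfLine hf hs hsh (W := W)
    (fun x y hxy => le_of_tendsto_of_tendsto' (hW x) (hW y) fun i => (hU i).mono hxy)
    (fun x => ge_of_tendsto' (hW x) fun i => (hU i).lower x)
    (fun x => le_of_tendsto' (hW x) fun i => (hU i).upper x)
    (fun x hx => tendsto_nhds_unique (hW x)
      (tendsto_const_nhds.congr fun i => ((hU i).left x hx).symm))
    (fun x hx => by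
      refine tendsto_nhds_unique ((hW x).congr' ?_)
        (((hf.continuous_plus.tendsto _).comp (hW _)).add
          ((hf.continuous_minus.tendsto _).comp (hW _)))
      filter_upwards [hK.eventually_ge_atTop x] with i hi
      exact (hU i).wave x hx hi) C
  have : u₀ ≤ W C := ge_of_tendsto (hW C) (hC'.mono fun i hi => hc i C hi)
  linarith

/-- A monotone solution of the travelling wave equation with values in `[uL, uR]` whose flux does
not exceed that of the end states. -/
structure IsWave (f : ℝ → ℝ) (s uL uR : ℝ) (W : ℝ → ℝ) : Prop where
  mono : Monotone W
  lower : ∀ x, uL ≤ W x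
  upper : ∀ x, W x ≤ uR
  wave : ∀ x, WaveAt f s W x
  flux : ∀ x, (1 - s) * plusFlux f (W (x - (1 - s))) - (1 + s) * minusFlux f (W (x + (1 + s)))
    ≤ f uL - s * uL

/-- Solutions on `[0, n]` are centred at their crossing of `u₀`, which recedes from both ends, and
an ultralimit is taken. The limit may still jump at `0`, hence one-sided inequalities instead of a
value there. -/
lemma exists_isWave {f : ℝ → ℝ} (hf : IsMonotoneFlux f) {s : ℝ} (hs : |s| < 1) {uL uR u₀ : ℝ}
    (hsh : IncreasingShock f s uL uR) (hL : uL < u₀) (hR : u₀ < uR) :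
    ∃ W, IsWave f s uL uR W ∧ (∀ x < 0, W x ≤ u₀) ∧ ∀ x, 0 < x → u₀ ≤ W x := by
  obtain ⟨h1, h2⟩ := abs_lt.1 hs
  have hex : ∀ n : ℕ, ∃ U, IsDomainSolution f s uL uR n U := fun n =>
    exists_domainSolution hf hsh.lt.le s n.cast_nonneg
  choose U hU using hex
  have hcross : ∀ n, ∃ c, (∀ x < c, U n x ≤ u₀) ∧ ∀ x, c < x → u₀ ≤ U n x := by
    intro n
    have hbdd : BddBelow {x | u₀ ≤ U n x} := by
      refine ⟨0, fun x hx => ?_⟩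
      by_contra hneg
      have := (hU n).left x (not_le.1 hneg)
      have hx' : u₀ ≤ U n x := hx
      linarith
    have hne : {x | u₀ ≤ U n x}.Nonempty :=
      ⟨n + 1, hR.le.trans ((hU n).right _ (lt_add_one _)).ge⟩
    refine ⟨sInf {x | u₀ ≤ U n x}, fun x hx => ?_, fun x hx => ?_⟩
    · exact (not_le.1 fun h => notMem_of_lt_csInf hx hbdd h).le
    · obtain ⟨y, hy, hyx⟩ := exists_lt_of_csInf_lt hne hx
      exact le_trans hy ((hU n).mono hyx.le)
  choose c hcl hcr using hcross
  let 𝒰 : Ultrafilter ℕ := hyperfilter ℕ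
  have h𝒰 : (𝒰 : Filter ℕ) ≤ atTop := by
    rw [← Nat.cofinite_eq_atTop]; exact hyperfilter_le_cofinite
  have hK : Tendsto (fun n : ℕ => (n : ℝ)) 𝒰 atTop := tendsto_natCast_atTop_atTop.mono_left h𝒰
  have hc1 : Tendsto c 𝒰 atTop := tendsto_crossing_atTop hf hs hsh hL hK hU hcr
  have hc2 : Tendsto (fun n : ℕ => (n : ℝ) - c n) 𝒰 atTop :=
    tendsto_crossing_atTop hf.comp_neg (by rwa [abs_neg]) hsh.comp_neg (neg_lt_neg hR) hK
      (fun n => (hU n).reflect) fun n x hx => neg_le_neg (hcl n _ (by linarith))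
  have hlim : ∀ x, ∃ w, Tendsto (fun n => U n (x + c n)) 𝒰 (𝓝 w) := fun x =>
    𝒰.exists_tendsto_of_eventually_mem_Icc
      (Eventually.of_forall fun i => ⟨(hU i).lower _, (hU i).upper _⟩)
  choose W hW using hlim
  have hin : ∀ x, ∀ᶠ n in (𝒰 : Filter ℕ), 0 ≤ x + c n ∧ x + c n ≤ n := by
    intro x
    filter_upwards [hc1.eventually_ge_atTop (-x), hc2.eventually_ge_atTop x] with n hn1 hn2
    constructor <;> linarith
  refine ⟨W, ⟨fun x y hxy => ?_, fun x => ?_, fun x => ?_, fun x => ?_, fun x => ?_⟩,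
    fun x hx => ?_, fun x hx => ?_⟩
  · exact le_of_tendsto_of_tendsto' (hW x) (hW y) fun n => (hU n).mono (by linarith)
  · exact ge_of_tendsto' (hW x) fun n => (hU n).lower _
  · exact le_of_tendsto' (hW x) fun n => (hU n).upper _
  · refine tendsto_nhds_unique ((hW x).congr' ?_)
        (((hf.continuous_plus.tendsto _).comp (hW _)).add
          ((hf.continuous_minus.tendsto _).comp (hW _)))
    filter_upwards [hin x] with n hn
    have := (hU n).wave _ hn.1 hn.2
    rw [WaveAt, add_sub_right_comm, add_right_comm] at this
    exact this
  · refine le_of_tendsto ((((hf.continuous_plus.tendsto _).comp (hW _)).const_mul _).sub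
          (((hf.continuous_minus.tendsto _).comp (hW _)).const_mul _)) ?_
    filter_upwards [hin x] with n hn
    have h3 := le_waveFlux hf hs (hU n).mono (x + c n)
    rw [← waveFlux_eq_of_waveAt hf (hU n).mono hn.1
      fun z hz hz' => (hU n).wave z hz (hz'.trans hn.2)] at h3
    have h4 := waveFlux_zero_le hf hs (hU n).mono (hU n).lower (hU n).left le_rfl
      (by linarith : (0:ℝ) ≤ 1 + s)
    have h5 := hf.minus.monotone ((hU n).lower 0)
    have h6 : 0 ≤ (1 + s - 0) * (minusFlux f (U n 0) - minusFlux f uL) :=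
      mul_nonneg (by linarith) (by linarith)
    rw [add_sub_right_comm, add_right_comm] at h3
    simp only [Function.comp_apply]
    linarith
  · exact le_of_tendsto' (hW x) fun n => hcl n _ (by linarith)
  · exact ge_of_tendsto' (hW x) fun n => hcr n _ (by linarith)

/-! ### Mass on the lattice and the Lipschitz bound -/

/-- The increments of `G` over steps of length `h`, summed over the lattice `x + 2ℤ`. -/
noncomputable def latticeMass (G : ℝ → ℝ) (x h : ℝ) : ENNReal :=
  ∑' j : ℤ, ENNReal.ofReal (G (x + 2 * j + h) - G (x + 2 * j))

lemma latticeMass_add {G : ℝ → ℝ} (hG : Monotone G) (x : ℝ) {h k : ℝ} (hh : 0 ≤ h) (hk : 0 ≤ k) :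
    latticeMass G x (h + k) = latticeMass G x h + latticeMass G (x + h) k := by
  unfold latticeMass
  rw [← ENNReal.tsum_add]
  refine tsum_congr fun j => ?_
  rw [← ENNReal.ofReal_add (sub_nonneg.2 (hG (by linarith))) (sub_nonneg.2 (hG (by linarith))),
    add_right_comm x h, add_assoc _ h k]
  congr 1; ring

lemma latticeMass_mono {G : ℝ → ℝ} (hG : Monotone G) (x : ℝ) {h k : ℝ} (hk : h ≤ k) :
    latticeMass G x h ≤ latticeMass G x k :=
  ENNReal.tsum_le_tsum fun j => ENNReal.ofReal_le_ofReal
    (sub_le_sub_right (hG (by linarith)) _)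

lemma latticeMass_add_two (G : ℝ → ℝ) (x h : ℝ) : latticeMass G (x + 2) h = latticeMass G x h := by
  unfold latticeMass
  rw [← (Equiv.addRight (1 : ℤ)).tsum_eq
    (fun j : ℤ => ENNReal.ofReal (G (x + 2 * j + h) - G (x + 2 * j)))]
  refine tsum_congr fun j => ?_
  simp only [Equiv.coe_addRight, Int.cast_add, Int.cast_one]
  rw [show x + 2 + 2 * (j : ℝ) = x + 2 * (j + 1) by ring]

/-- The points `x - (1 - s)` and `x + (1 + s)` differ by 2 and span the same lattice. Summing the
wave equation over `x + 2ℤ` therefore recombines the two fluxes at `x + (1 + s)`. -/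
lemma IsWave.latticeMass_add_speed {f : ℝ → ℝ} (hf : IsMonotoneFlux f) {s uL uR : ℝ}
    {W : ℝ → ℝ} (hW : IsWave f s uL uR W) (x : ℝ) {h : ℝ} (hh : 0 ≤ h) :
    latticeMass W (x + (1 + s)) h = latticeMass W x h := by
  have hp : Monotone fun z => plusFlux f (W z) := hf.plus.monotone.comp hW.mono
  have hm : Monotone fun z => minusFlux f (W z) := hf.minus.monotone.comp hW.mono
  have e1 : latticeMass W (x + (1 + s)) h = latticeMass (fun z => plusFlux f (W z)) (x + (1 + s)) h
      + latticeMass (fun z => minusFlux f (W z)) (x + (1 + s)) h := by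
    unfold latticeMass
    rw [← ENNReal.tsum_add]
    refine tsum_congr fun j => ?_
    rw [← ENNReal.ofReal_add (sub_nonneg.2 (hp (by linarith))) (sub_nonneg.2 (hm (by linarith)))]
    have h1 := plusFlux_add_minusFlux f (W (x + (1 + s) + 2 * (j : ℝ) + h))
    have h2 := plusFlux_add_minusFlux f (W (x + (1 + s) + 2 * (j : ℝ)))
    congr 1
    linarith
  have e2 : latticeMass W x h = latticeMass (fun z => plusFlux f (W z)) (x - (1 - s)) h
      + latticeMass (fun z => minusFlux f (W z)) (x + (1 + s)) h := by
    unfold latticeMass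
    rw [← ENNReal.tsum_add]
    refine tsum_congr fun j => ?_
    rw [← ENNReal.ofReal_add (sub_nonneg.2 (hp (by linarith))) (sub_nonneg.2 (hm (by linarith)))]
    have w1 := hW.wave (x + 2 * j + h)
    have w2 := hW.wave (x + 2 * j)
    unfold WaveAt at w1 w2
    rw [show x - (1 - s) + 2 * (j : ℝ) + h = x + 2 * j + h - (1 - s) by ring,
      show x + (1 + s) + 2 * (j : ℝ) + h = x + 2 * j + h + (1 + s) by ring,
      show x - (1 - s) + 2 * (j : ℝ) = x + 2 * j - (1 - s) by ring,
      show x + (1 + s) + 2 * (j : ℝ) = x + 2 * j + (1 + s) by ring]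
    congr 1; linarith
  rw [e1, e2, ← latticeMass_add_two _ (x - (1 - s)), show x - (1 - s) + 2 = x + (1 + s) by ring]

lemma latticeMass_two_le {G : ℝ → ℝ} (hG : Monotone G) {a b : ℝ} (ha : ∀ x, a ≤ G x)
    (hb : ∀ x, G x ≤ b) (x : ℝ) : latticeMass G x 2 ≤ ENNReal.ofReal (b - a) := by
  refine ENNReal.summable.tsum_le_of_sum_le fun t => ?_
  obtain ⟨m, n, hmn⟩ : ∃ (m : ℤ) (n : ℕ), t ⊆ (Finset.range n).image fun i : ℕ => m + (i : ℤ) := by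
    rcases t.eq_empty_or_nonempty with rfl | hne
    · exact ⟨0, 0, by simp⟩
    · refine ⟨t.min' hne, (t.max' hne - t.min' hne).toNat + 1, fun j hj => ?_⟩
      have h1 := t.min'_le j hj
      have h2 := t.le_max' j hj
      exact Finset.mem_image.2 ⟨(j - t.min' hne).toNat, Finset.mem_range.2 (by omega), by omega⟩
  refine (Finset.sum_le_sum_of_subset hmn).trans ?_
  rw [Finset.sum_image (fun i _ j _ hij => by simpa using hij),
    ← ENNReal.ofReal_sum_of_nonneg fun i _ => sub_nonneg.2 (hG (by linarith))]
  refine ENNReal.ofReal_le_ofReal ?_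
  have := Finset.sum_range_sub (fun i : ℕ => G (x + 2 * (m + (i : ℝ)))) n
  have e : ∀ i : ℕ, G (x + 2 * ((m + (i : ℤ) : ℤ) : ℝ) + 2) - G (x + 2 * ((m + (i : ℤ) : ℤ) : ℝ))
      = G (x + 2 * (m + ((i + 1 : ℕ) : ℝ))) - G (x + 2 * (m + (i : ℝ))) := by
    intro i
    push_cast
    rw [show x + 2 * ((m:ℝ) + i) + 2 = x + 2 * (m + (i + 1)) by ring]
  rw [Finset.sum_congr rfl fun i _ => e i, this]
  linarith [hb (x + 2 * (m + (n : ℝ))), ha (x + 2 * (m + ((0 : ℕ) : ℝ)))]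

lemma latticeMass_two_mul_le {G : ℝ → ℝ} (hG : Monotone G) {a b : ℝ} (ha : ∀ x, a ≤ G x)
    (hb : ∀ x, G x ≤ b) (x : ℝ) (n : ℕ) :
    latticeMass G x (2 * n) ≤ n * ENNReal.ofReal (b - a) := by
  induction n with
  | zero => simp [latticeMass]
  | succ n ih =>
    rw [Nat.cast_succ, mul_add_one, latticeMass_add hG x (by positivity) zero_le_two,
      Nat.cast_succ, add_mul, one_mul]
    exact add_le_add ih (latticeMass_two_le hG ha hb _)

/-- The mass is additive in `h` and invariant under the dense group generated by `1 + s` and `2`.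
Together with the total `uR - uL` available at `h = 2`, this bounds it by the linear function. -/
lemma IsWave.latticeMass_le {f : ℝ → ℝ} (hf : IsMonotoneFlux f) {s uL uR : ℝ} {W : ℝ → ℝ}
    (hW : IsWave f s uL uR W) (hs : Irrational s) (x : ℝ) {h : ℝ} (hh : 0 ≤ h) :
    latticeMass W x h ≤ ENNReal.ofReal ((uR - uL) / 2 * h) := by
  have hD : 0 ≤ uR - uL := sub_nonneg.2 ((hW.lower 0).trans (hW.upper 0))
  have hdense : Dense (AddSubgroup.closure {1 + s, 2} : Set ℝ) := by
    refine dense_addSubgroupClosure_pair_iff.2 ?_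
    have h1 : Irrational (((1 : ℕ) : ℝ) + s) := irrational_natCast_add_iff.2 hs
    have h2 : Irrational ((((1 : ℕ) : ℝ) + s) / ((2 : ℕ) : ℝ)) := h1.div_natCast two_ne_zero
    simpa using h2
  have hinv : ∀ t ∈ AddSubgroup.closure {1 + s, 2}, ∀ x k, 0 ≤ k →
      latticeMass W (x + t) k = latticeMass W x k := by
    intro t ht
    induction ht using AddSubgroup.closure_induction with
    | mem t ht =>
      rcases ht with rfl | rfl
      · exact fun x k hk => hW.latticeMass_add_speed hf x hk
      · exact fun x k hk => latticeMass_add_two W x k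
    | zero => simp
    | add t t' _ _ h1 h2 => exact fun x k hk => by rw [← add_assoc, h2 _ k hk, h1 x k hk]
    | neg t _ h1 => exact fun x k hk => by rw [← h1 (x + -t) k hk, neg_add_cancel_right]
  have hmul : ∀ t ∈ AddSubgroup.closure {1 + s, 2}, 0 ≤ t → ∀ N : ℕ,
      latticeMass W x (N * t) = N * latticeMass W x t := by
    intro t ht ht0 N
    induction N with
    | zero => simp [latticeMass]
    | succ N ih =>
      rw [Nat.cast_succ, add_mul, one_mul, latticeMass_add hW.mono x (by positivity) ht0, ih,
        hinv _ (nsmul_eq_mul N t ▸ AddSubgroup.nsmul_mem _ ht N) x t ht0, Nat.cast_succ, add_mul,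
        one_mul]
  have hΓ : ∀ t ∈ AddSubgroup.closure {1 + s, 2}, 0 ≤ t →
      latticeMass W x t ≤ ENNReal.ofReal ((uR - uL) / 2 * t) := by
    intro t ht ht0
    -- Cover `(N + 1) * t` by `n` full periods of length 2. The rounding costs one period, which
    -- disappears after division by `N + 1`.
    have hN : ∀ N : ℕ, latticeMass W x t ≤
        ENNReal.ofReal ((uR - uL) / 2 * t + (uR - uL) * (1 / ((N : ℝ) + 1))) := by
      intro N
      have hN0 : (0 : ℝ) < (N : ℝ) + 1 := by positivity
      have hN' : ((N + 1 : ℕ) : ENNReal) ≠ 0 := by simp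
      rw [← ENNReal.mul_le_mul_iff_right hN' (ENNReal.natCast_ne_top _), ← hmul t ht ht0,
        ← ENNReal.ofReal_natCast, ← ENNReal.ofReal_mul (by positivity)]
      set n := ⌊((N + 1 : ℕ) : ℝ) * t / 2⌋₊ + 1 with hn
      have hn1 : ((N + 1 : ℕ) : ℝ) * t / 2 < n := by
        rw [hn]; push_cast; exact Nat.lt_floor_add_one _
      have hn2 : (n : ℝ) ≤ ((N + 1 : ℕ) : ℝ) * t / 2 + 1 := by
        rw [hn]; push_cast
        have := Nat.floor_le (show 0 ≤ ((N + 1 : ℕ) : ℝ) * t / 2 by positivity)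
        push_cast at this
        linarith
      refine (latticeMass_mono hW.mono x (by linarith : _ ≤ 2 * (n : ℝ))).trans
        ((latticeMass_two_mul_le hW.mono hW.lower hW.upper x n).trans ?_)
      rw [← ENNReal.ofReal_natCast, ← ENNReal.ofReal_mul (by positivity)]
      refine ENNReal.ofReal_le_ofReal ?_
      have : ((N + 1 : ℕ) : ℝ) * ((uR - uL) / 2 * t + (uR - uL) * (1 / ((N : ℝ) + 1))) =
          (((N + 1 : ℕ) : ℝ) * t / 2 + 1) * (uR - uL) := by
        push_cast; field_simp
      rw [this]
      exact mul_le_mul_of_nonneg_right hn2 hD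
    have hlim : Tendsto (fun N : ℕ => ENNReal.ofReal ((uR - uL) / 2 * t +
        (uR - uL) * (1 / ((N : ℝ) + 1)))) atTop (𝓝 (ENNReal.ofReal ((uR - uL) / 2 * t))) := by
      refine ENNReal.tendsto_ofReal ?_
      simpa using (tendsto_one_div_add_atTop_nhds_zero_nat.const_mul (uR - uL)).const_add
        ((uR - uL) / 2 * t)
    exact ge_of_tendsto' hlim hN
  have hlim : Tendsto (fun k => ENNReal.ofReal ((uR - uL) / 2 * k)) (𝓝[>] h)
      (𝓝 (ENNReal.ofReal ((uR - uL) / 2 * h))) :=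
    (ENNReal.continuous_ofReal.comp (continuous_const.mul continuous_id)).continuousAt.mono_left
      nhdsWithin_le_nhds
  refine ge_of_tendsto hlim ?_
  filter_upwards [self_mem_nhdsWithin] with k hk
  obtain ⟨t, ht, htΓ⟩ := hdense.exists_between (show h < k from hk)
  refine (latticeMass_mono hW.mono x htΓ.1.le).trans ((hΓ t ht (hh.trans htΓ.1.le)).trans ?_)
  exact ENNReal.ofReal_le_ofReal (mul_le_mul_of_nonneg_left htΓ.2.le (by linarith))

/-! ### Balanced waves and their limits -/

/-- A wave whose phase is parametrized by mass and which takes the value `u₀` at the origin. -/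
structure IsBalancedWave (f : ℝ → ℝ) (s uL uR u₀ : ℝ) (U : ℝ → ℝ) : Prop
    extends IsWave f s uL uR U where
  mass : ∀ x h, 0 ≤ h → ∀ n : ℕ,
    ∑ i ∈ Finset.range n, (U (x + 2 * i + h) - U (x + 2 * i)) ≤ (uR - uL) / 2 * h
  zero : U 0 = u₀

lemma IsBalancedWave.sub_le {f : ℝ → ℝ} {s uL uR u₀ : ℝ} {U : ℝ → ℝ}
    (h : IsBalancedWave f s uL uR u₀ U) {x y : ℝ} (hxy : x ≤ y) :
    U y - U x ≤ (uR - uL) / 2 * (y - x) := by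
  simpa using h.mass x (y - x) (sub_nonneg.2 hxy) 1

lemma IsBalancedWave.abs_sub_le {f : ℝ → ℝ} {s uL uR u₀ : ℝ} {U : ℝ → ℝ}
    (h : IsBalancedWave f s uL uR u₀ U) (x y : ℝ) :
    |U y - U x| ≤ (uR - uL) / 2 * |y - x| := by
  rcases le_total x y with hxy | hxy
  · rw [abs_of_nonneg (sub_nonneg.2 hxy), abs_of_nonneg (sub_nonneg.2 (h.mono hxy))]
    exact h.sub_le hxy
  · rw [abs_sub_comm, abs_sub_comm y, abs_of_nonneg (sub_nonneg.2 hxy),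
      abs_of_nonneg (sub_nonneg.2 (h.mono hxy))]
    exact h.sub_le hxy

/-- The mass bound makes the wave Lipschitz, so the one-sided inequalities at the crossing become
the value `u₀`. -/
lemma exists_isBalancedWave_of_irrational {f : ℝ → ℝ} (hf : IsMonotoneFlux f) {s : ℝ}
    (hs : |s| < 1) (hirr : Irrational s) {uL uR u₀ : ℝ} (hsh : IncreasingShock f s uL uR)
    (hL : uL < u₀) (hR : u₀ < uR) : ∃ U, IsBalancedWave f s uL uR u₀ U := by
  obtain ⟨U, hU, hneg, hpos⟩ := exists_isWave hf hs hsh hL hR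
  have hD : 0 < uR - uL := by linarith
  have hmass : ∀ x h, 0 ≤ h → ∀ n : ℕ,
      ∑ i ∈ Finset.range n, (U (x + 2 * i + h) - U (x + 2 * i)) ≤ (uR - uL) / 2 * h := by
    intro x h hh n
    have h1 := hU.latticeMass_le hf hirr x hh
    rw [← ENNReal.ofReal_le_ofReal_iff (by positivity), ENNReal.ofReal_sum_of_nonneg
      fun i _ => sub_nonneg.2 (hU.mono (by linarith))]
    refine le_trans ?_ h1
    unfold latticeMass
    refine le_trans (le_of_eq ?_) (ENNReal.sum_le_tsum ((Finset.range n).image fun i : ℕ => (i : ℤ)))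
    rw [Finset.sum_image (fun i _ j _ hij => by simpa using hij)]
    simp
  refine ⟨U, hU, hmass, ?_⟩
  have hlip : ∀ x y, x ≤ y → U y - U x ≤ (uR - uL) / 2 * (y - x) := fun x y hxy => by
    simpa using hmass x (y - x) (sub_nonneg.2 hxy) 1
  refine le_antisymm (le_of_forall_pos_le_add fun ε hε => ?_)
    (le_of_forall_pos_le_add fun ε hε => ?_)
  · have h1 := hlip (-(ε / (uR - uL))) 0 (by have : 0 < ε / (uR - uL) := by positivity
                                             linarith)
    have h2 := hneg (-(ε / (uR - uL))) (neg_neg_of_pos (by positivity))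
    have h3 : (uR - uL) / 2 * (0 - -(ε / (uR - uL))) = ε / 2 := by field_simp; ring
    linarith
  · have h1 := hlip 0 (ε / (uR - uL)) (by positivity)
    have h2 := hpos (ε / (uR - uL)) (by positivity)
    have h3 : (uR - uL) / 2 * (ε / (uR - uL) - 0) = ε / 2 := by field_simp; ring
    linarith

lemma isBalancedWave_of_tendsto {ι : Type*} {F : Filter ι} [F.NeBot] {f : ℝ → ℝ}
    (hf : IsMonotoneFlux f) {s uL uR : ι → ℝ} {s' uL' uR' u₀ : ℝ} {V : ι → ℝ → ℝ} {U : ℝ → ℝ}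
    (h : ∀ᶠ i in F, IsBalancedWave f (s i) (uL i) (uR i) u₀ (V i))
    (hs : Tendsto s F (𝓝 s')) (hL : Tendsto uL F (𝓝 uL')) (hR : Tendsto uR F (𝓝 uR'))
    (hU : ∀ x, Tendsto (fun i => V i x) F (𝓝 (U x))) : IsBalancedWave f s' uL' uR' u₀ U := by
  -- Equi-Lipschitz continuity lets pointwise limits be taken along moving arguments, as needed when
  -- the speed varies.
  have hmove : ∀ {y : ι → ℝ} {y' : ℝ}, Tendsto y F (𝓝 y') →
      Tendsto (fun i => V i (y i)) F (𝓝 (U y')) := by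
    intro y y' hy
    have hd : Tendsto (fun i => V i (y i) - V i y') F (𝓝 0) := by
      have hb : Tendsto (fun i => (uR i - uL i) / 2 * |y i - y'|) F (𝓝 0) := by
        simpa using ((hR.sub hL).div_const 2).mul (hy.sub_const y').abs
      refine squeeze_zero_norm' ?_ hb
      filter_upwards [h] with i hi
      exact hi.abs_sub_le y' (y i)
    simpa using hd.add (hU y')
  have hl : ∀ x, Tendsto (fun i => V i (x - (1 - s i))) F (𝓝 (U (x - (1 - s')))) := fun x =>
    hmove ((hs.const_sub 1).const_sub x)
  have hr : ∀ x, Tendsto (fun i => V i (x + (1 + s i))) F (𝓝 (U (x + (1 + s')))) := fun x =>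
    hmove ((hs.const_add 1).const_add x)
  refine ⟨⟨fun x y hxy => ?_, fun x => ?_, fun x => ?_, fun x => ?_, fun x => ?_⟩,
    fun x k hk n => ?_, ?_⟩
  · exact le_of_tendsto_of_tendsto (hU x) (hU y) (h.mono fun i hi => hi.mono hxy)
  · exact le_of_tendsto_of_tendsto hL (hU x) (h.mono fun i hi => hi.lower x)
  · exact le_of_tendsto_of_tendsto (hU x) hR (h.mono fun i hi => hi.upper x)
  · exact tendsto_nhds_unique ((hU x).congr' (h.mono fun i hi => hi.wave x))
      (((hf.continuous_plus.tendsto _).comp (hl x)).add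
        ((hf.continuous_minus.tendsto _).comp (hr x)))
  · exact le_of_tendsto_of_tendsto
      (((hs.const_sub 1).mul ((hf.continuous_plus.tendsto _).comp (hl x))).sub
        ((hs.const_add 1).mul ((hf.continuous_minus.tendsto _).comp (hr x))))
      (((hf.cont.tendsto _).comp hL).sub (hs.mul hL)) (h.mono fun i hi => hi.flux x)
  · exact le_of_tendsto_of_tendsto (tendsto_finsetSum _ fun i _ => (hU _).sub (hU _))
      (((hR.sub hL).div_const 2).mul_const k) (h.mono fun i hi => hi.mass x k hk n)
  · exact tendsto_nhds_unique (hU 0) (tendsto_const_nhds.congr' (h.mono fun i hi => hi.zero.symm))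

lemma IsWave.flux_le_of_tendsto {f : ℝ → ℝ} (hf : IsMonotoneFlux f) {s uL uR : ℝ} {U : ℝ → ℝ}
    (hU : IsWave f s uL uR U) {F : Filter ℝ} [F.NeBot] (hF : ∀ c, Tendsto (fun x => x + c) F F)
    {w : ℝ} (hw : Tendsto U F (𝓝 w)) : f w - s * w ≤ f uL - s * uL := by
  have t3 := (((hf.continuous_plus.tendsto w).comp (hw.comp (hF (-(1 - s))))).const_mul (1 - s)).sub
    (((hf.continuous_minus.tendsto w).comp (hw.comp (hF (1 + s)))).const_mul (1 + s))
  rw [flux_const_eq] at t3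
  exact le_of_tendsto t3 (Eventually.of_forall fun x => hU.flux x)

/-- The flux bound and the Oleinik condition leave only the end states as limits; the value `u₀` at
the origin excludes the wrong one. -/
lemma IsBalancedWave.tendsto_atBot {f : ℝ → ℝ} (hf : IsMonotoneFlux f) {s uL uR u₀ : ℝ}
    {U : ℝ → ℝ} (hU : IsBalancedWave f s uL uR u₀ U) (hsh : IncreasingShock f s uL uR)
    (hR : u₀ < uR) : Tendsto U atBot (𝓝 uL) := by
  obtain ⟨w, hlim⟩ : ∃ w, Tendsto U atBot (𝓝 w) :=
    ⟨_, tendsto_atBot_ciInf hU.mono ⟨uL, by rintro _ ⟨x, rfl⟩; exact hU.lower x⟩⟩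
  have h0 : w ≤ u₀ := by
    refine le_of_tendsto hlim ?_
    filter_upwards [eventually_le_atBot 0] with x hx
    exact (hU.mono hx).trans hU.zero.le
  have hφ := hU.flux_le_of_tendsto hf (fun c => tendsto_atBot_add_const_right _ c tendsto_id) hlim
  rcases hsh.eq_or_eq (ge_of_tendsto' hlim hU.lower) (by linarith) hφ with h | h
  · rwa [← h]
  · linarith

lemma IsBalancedWave.tendsto_atTop {f : ℝ → ℝ} (hf : IsMonotoneFlux f) {s uL uR u₀ : ℝ}
    {U : ℝ → ℝ} (hU : IsBalancedWave f s uL uR u₀ U) (hsh : IncreasingShock f s uL uR)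
    (hL : uL < u₀) : Tendsto U atTop (𝓝 uR) := by
  obtain ⟨w, hlim⟩ : ∃ w, Tendsto U atTop (𝓝 w) :=
    ⟨_, tendsto_atTop_ciSup hU.mono ⟨uR, by rintro _ ⟨x, rfl⟩; exact hU.upper x⟩⟩
  have h0 : u₀ ≤ w := by
    refine ge_of_tendsto hlim ?_
    filter_upwards [eventually_ge_atTop 0] with x hx
    exact hU.zero.ge.trans (hU.mono hx)
  have hφ := hU.flux_le_of_tendsto hf (fun c => tendsto_atTop_add_const_right _ c tendsto_id) hlim
  rcases hsh.eq_or_eq (by linarith) (le_of_tendsto' hlim hU.upper) hφ with h | h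
  · linarith
  · rwa [← h]

/-! ### Strict monotonicity at rational speeds -/

/-- The increment of `U` is a sum of two nonnegative flux increments; if it vanishes, so do both. -/
lemma IsWave.eq_shift {f : ℝ → ℝ} (hf : IsMonotoneFlux f) {s uL uR : ℝ} {U : ℝ → ℝ}
    (hU : IsWave f s uL uR U) {x h : ℝ} (hh : 0 ≤ h) (hx : U (x + h) = U x) :
    U (x + (1 + s) + h) = U (x + (1 + s)) ∧ U (x - (1 - s) + h) = U (x - (1 - s)) := by
  have w1 := hU.wave (x + h)
  have w2 := hU.wave x
  have m1 := hf.plus.monotone (hU.mono (show x - (1 - s) ≤ x - (1 - s) + h by linarith))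
  have m2 := hf.minus.monotone (hU.mono (show x + (1 + s) ≤ x + (1 + s) + h by linarith))
  rw [WaveAt, hx, w2, add_sub_right_comm, add_right_comm x h] at w1
  exact ⟨hf.minus.injective (by linarith), hf.plus.injective (by linarith)⟩

/-- A flat piece of length `h` would repeat along a lattice of step 2. The complementary pieces, of
length `2 - h`, would then carry the whole jump, more than the mass bound allows. -/
lemma IsBalancedWave.strictMono {f : ℝ → ℝ} (hf : IsMonotoneFlux f) {uL uR u₀ : ℝ} {p q : ℕ}
    (hpq : p < q) {U : ℝ → ℝ} (hU : IsBalancedWave f (p / q) uL uR u₀ U)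
    (hsh : IncreasingShock f (p / q) uL uR) (hL : uL < u₀) (hR : u₀ < uR) : StrictMono U := by
  have hq : (q : ℝ) ≠ 0 := by
    have : q ≠ 0 := by omega
    exact_mod_cast this
  have key : ∀ x h, 0 < h → h ≤ 2 → U (x + h) ≠ U x := by
    intro x h h0 h2 heq
    have hr : ∀ n : ℕ, ∀ y, U (y + h) = U y →
        U (y + n * (1 + p / q) + h) = U (y + n * (1 + (p : ℝ) / q)) := by
      intro n
      induction n with
      | zero => simp
      | succ n ih =>
        intro y hy
        have := (hU.eq_shift hf h0.le (ih y hy)).1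
        rw [Nat.cast_succ, add_mul, one_mul, ← add_assoc]
        exact this
    have hl : ∀ n : ℕ, ∀ y, U (y + h) = U y →
        U (y - n * (1 - p / q) + h) = U (y - n * (1 - (p : ℝ) / q)) := by
      intro n
      induction n with
      | zero => simp
      | succ n ih =>
        intro y hy
        have := (hU.eq_shift hf h0.le (ih y hy)).2
        rw [Nat.cast_succ, add_mul, one_mul, ← sub_sub]
        exact this
    have hp2 : ∀ y, U (y + h) = U y → U (y + 2 + h) = U (y + 2) := by
      intro y hy
      -- The counts solve `a * (1 + p/q) - b * (1 - p/q) = 2` in natural numbers; the pair used for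
      -- `hm2` gives `-2`.
      have := hl (q + p - 1) _ (hr (q - p + 1) y hy)
      have e : y + ((q - p + 1 : ℕ) : ℝ) * (1 + p / q) - ((q + p - 1 : ℕ) : ℝ) * (1 - p / q)
          = y + 2 := by
        rw [Nat.cast_sub (by omega), Nat.cast_add, Nat.cast_sub hpq.le]
        push_cast
        field_simp
        ring
      rwa [e] at this
    have hm2 : ∀ y, U (y + h) = U y → U (y - 2 + h) = U (y - 2) := by
      intro y hy
      have := hl (q + p + 1) _ (hr (q - p - 1) y hy)
      have e : y + ((q - p - 1 : ℕ) : ℝ) * (1 + p / q) - ((q + p + 1 : ℕ) : ℝ) * (1 - p / q)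
          = y - 2 := by
        rw [Nat.sub_sub, Nat.cast_sub (by omega)]
        push_cast
        field_simp
        ring
      rwa [e] at this
    have hleft : ∀ n : ℕ, U (x - 2 * n + h) = U (x - 2 * n) := by
      intro n
      induction n with
      | zero => simpa using heq
      | succ n ih =>
        have := hm2 _ ih
        rwa [sub_sub, ← mul_add_one, ← Nat.cast_succ] at this
    have hall : ∀ N n : ℕ, U (x - 2 * N + 2 * n + h) = U (x - 2 * N + 2 * n) := by
      intro N n
      induction n with
      | zero => simpa using hleft N
      | succ n ih =>
        have := hp2 _ ih
        rwa [add_assoc (x - 2 * (N : ℝ)), ← mul_add_one, ← Nat.cast_succ] at this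
    have hbound : ∀ N : ℕ, U (x + 2 * N) - U (x - 2 * N) ≤ (uR - uL) / 2 * (2 - h) := by
      intro N
      have hm := hU.mass (x - 2 * N + h) (2 - h) (by linarith) (2 * N)
      have hs := Finset.sum_range_sub (fun i : ℕ => U (x - 2 * N + 2 * i)) (2 * N)
      have e : ∀ i : ℕ, U (x - 2 * N + h + 2 * i + (2 - h)) - U (x - 2 * N + h + 2 * i) =
          U (x - 2 * N + 2 * ((i + 1 : ℕ) : ℝ)) - U (x - 2 * N + 2 * i) := by
        intro i
        rw [← hall N i]
        push_cast
        congr 2 <;> ring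
      rw [Finset.sum_congr rfl fun i _ => e i, hs] at hm
      convert hm using 2
      · congr 1; push_cast; ring
      · simp
    have t1 : Tendsto (fun N : ℕ => x + 2 * (N : ℝ)) atTop atTop :=
      tendsto_atTop_add_const_left _ _ (tendsto_natCast_atTop_atTop.const_mul_atTop two_pos)
    have t2 : Tendsto (fun N : ℕ => x - 2 * (N : ℝ)) atTop atBot :=
      tendsto_atBot_add_const_left _ _ (tendsto_neg_atTop_atBot.comp
        (tendsto_natCast_atTop_atTop.const_mul_atTop two_pos))
    have := le_of_tendsto' (((hU.tendsto_atTop hf hsh hL).comp t1).sub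
      ((hU.tendsto_atBot hf hsh hR).comp t2)) hbound
    nlinarith [mul_pos (sub_pos.2 hsh.lt) h0]
  intro x y hxy
  have h1 : 0 < min (y - x) 2 := lt_min (sub_pos.2 hxy) two_pos
  have h2 := (hU.mono (show x ≤ x + min (y - x) 2 by linarith)).lt_of_ne
    (key x _ h1 (min_le_right _ _)).symm
  exact h2.trans_le (hU.mono (by linarith [min_le_left (y - x) 2]))

/-! ### Nearby shocks and waves of every speed -/

lemma exists_last_crossing {φ : ℝ → ℝ} (hφ : Continuous φ) {a b c : ℝ} (hab : a < b)
    (ha : φ a ≤ c) (hb : c < φ b) :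
    ∃ l, a ≤ l ∧ l < b ∧ φ l = c ∧ ∀ u, l < u → u ≤ b → c < φ u := by
  set S := Set.Icc a b ∩ φ ⁻¹' Set.Iic c with hS
  have hcpt : IsCompact S := isCompact_Icc.inter_right (isClosed_Iic.preimage hφ)
  obtain ⟨l, hl, hmax⟩ := hcpt.exists_isGreatest ⟨a, ⟨le_rfl, hab.le⟩, ha⟩
  have hlt : ∀ u, l < u → u ≤ b → c < φ u := fun u hu hub => by
    by_contra hcu
    exact absurd (hmax ⟨⟨hl.1.1.trans hu.le, hub⟩, not_lt.1 hcu⟩) (not_le.2 hu)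
  have hlb : l < b := lt_of_le_of_ne hl.1.2 fun h => absurd hl.2 (by
    rw [h]; exact not_le.2 hb)
  refine ⟨l, hl.1.1, hlb, le_antisymm hl.2 ?_, hlt⟩
  refine ge_of_tendsto (hφ.continuousAt.mono_left nhdsWithin_le_nhds : Tendsto φ (𝓝[>] l) _) ?_
  filter_upwards [Ioo_mem_nhdsGT hlb] with u hu
  exact (hlt u hu.1 hu.2.le).le

lemma exists_first_crossing {φ : ℝ → ℝ} (hφ : Continuous φ) {a b c : ℝ} (hab : a < b)
    (ha : c < φ a) (hb : φ b ≤ c) :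
    ∃ l, a < l ∧ l ≤ b ∧ φ l = c ∧ ∀ u, a ≤ u → u < l → c < φ u := by
  obtain ⟨l, h1, h2, h3, h4⟩ := exists_last_crossing (φ := fun u => φ (-u))
    (hφ.comp continuous_neg) (neg_lt_neg hab) (by simpa using hb) (by simpa using ha)
  refine ⟨-l, by linarith, by linarith, h3, fun u hau hul => ?_⟩
  simpa using h4 (-u) (by linarith) (by linarith)

/-- For slope `t`, cut the graph of `f u - t * u` at the larger of its values at `uL` and `uR`. The
crossings nearest to `u₀` on either side are the new end states. -/
lemma IncreasingShock.exists_nearby {f : ℝ → ℝ} (hf : Continuous f) {s uL uR u₀ : ℝ}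
    (h : IncreasingShock f s uL uR) (hL : uL < u₀) (hR : u₀ < uR) :
    ∃ l r : ℝ → ℝ, Tendsto l (𝓝 s) (𝓝 uL) ∧ Tendsto r (𝓝 s) (𝓝 uR) ∧
      ∀ᶠ t in 𝓝 s, IncreasingShock f t (l t) (r t) ∧ l t < u₀ ∧ u₀ < r t := by
  have hc : ∀ t, Continuous fun u => f u - t * u := fun t => by fun_prop
  have ht : ∀ u, Tendsto (fun t => f u - t * u) (𝓝 s) (𝓝 (f u - s * u)) := fun u =>
    Continuous.tendsto (by fun_prop) s
  set c : ℝ → ℝ := fun t => max (f uL - t * uL) (f uR - t * uR) with hcdef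
  have hct : Tendsto c (𝓝 s) (𝓝 (f uL - s * uL)) := by
    have := (ht uL).max (ht uR)
    rwa [h.rankineHugoniot, max_self] at this
  have hc0 : ∀ᶠ t in 𝓝 s, c t < f u₀ - t * u₀ :=
    hct.eventually_lt (ht u₀) (h.oleinik u₀ ⟨hL, hR⟩)
  have hex : ∀ᶠ t in 𝓝 s, ∃ lr : ℝ × ℝ, (uL ≤ lr.1 ∧ lr.1 < u₀ ∧ u₀ < lr.2 ∧ lr.2 ≤ uR) ∧
      f lr.1 - t * lr.1 = c t ∧ f lr.2 - t * lr.2 = c t ∧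
        ∀ u ∈ Set.Ioo lr.1 lr.2, c t < f u - t * u := by
    filter_upwards [hc0] with t h0
    obtain ⟨l, l1, l2, l3, l4⟩ := exists_last_crossing (hc t) hL (le_max_left _ _) h0
    obtain ⟨r, r1, r2, r3, r4⟩ := exists_first_crossing (hc t) hR h0 (le_max_right _ _)
    refine ⟨(l, r), ⟨l1, l2, r1, r2⟩, l3, r3, fun u hu => ?_⟩
    rcases le_total u u₀ with hu' | hu'
    · exact l4 u hu.1 hu'
    · exact r4 u hu' hu.2
  obtain ⟨lr, hlr⟩ := hex.choice
  -- On compact subintervals of `(uL, uR)` the Oleinik gap is uniform and persists for `t` near `s`,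
  -- so the crossings are pushed to the end states.
  have hfar : ∀ a b, uL < a → b < uR → a ≤ b → ∀ᶠ t in 𝓝 s, ∀ u ∈ Set.Icc a b,
      c t < f u - t * u := by
    intro a b ha hb hab
    obtain ⟨m, hm, hmin⟩ := isCompact_Icc.exists_isMinOn (Set.nonempty_Icc.2 hab)
      (hc s).continuousOn
    have hgap : f uL - s * uL < f m - s * m := h.oleinik m ⟨ha.trans_le hm.1, hm.2.trans_lt hb⟩
    have hsm : Tendsto (fun t => c t + |t - s| * (|a| + |b|)) (𝓝 s)
        (𝓝 (f uL - s * uL + |s - s| * (|a| + |b|))) :=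
      hct.add (((continuous_id.sub continuous_const).abs.tendsto s).mul_const _)
    rw [sub_self, abs_zero, zero_mul, add_zero] at hsm
    filter_upwards [hsm.eventually_lt tendsto_const_nhds hgap] with t htm u hu
    have h1 : f m - s * m ≤ f u - s * u := hmin hu
    have h2 : |u| ≤ |a| + |b| := by
      rcases abs_cases u with ⟨e, _⟩ | ⟨e, _⟩ <;> rw [e]
      · linarith [hu.2, le_abs_self b, abs_nonneg a]
      · linarith [hu.1, neg_abs_le a, abs_nonneg b]
    have h3 : (t - s) * u ≤ |t - s| * (|a| + |b|) := (le_abs_self _).trans (by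
      rw [abs_mul]; exact mul_le_mul_of_nonneg_left h2 (abs_nonneg _))
    linarith
  refine ⟨fun t => (lr t).1, fun t => (lr t).2, ?_, ?_, ?_⟩
  · refine tendsto_order.2 ⟨fun a ha => ?_, fun a ha => ?_⟩
    · filter_upwards [hlr] with t h1
      exact ha.trans_le h1.1.1
    · filter_upwards [hlr, hfar (min a u₀) u₀ (lt_min ha hL) hR (min_le_right _ _)] with t h1 h2
      by_contra hcon
      exact absurd h1.2.1 (h2 _ ⟨(min_le_left _ _).trans (not_lt.1 hcon), h1.1.2.1.le⟩).ne'
  · refine tendsto_order.2 ⟨fun a ha => ?_, fun a ha => ?_⟩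
    · filter_upwards [hlr, hfar u₀ (max a u₀) hL (max_lt ha hR) (le_max_right _ _)] with t h1 h2
      by_contra hcon
      exact absurd h1.2.2.1
        (h2 _ ⟨h1.1.2.2.1.le, (not_lt.1 hcon).trans (le_max_left _ _)⟩).ne'
    · filter_upwards [hlr] with t h1
      exact h1.1.2.2.2.trans_lt ha
  · filter_upwards [hlr] with t h1
    exact ⟨⟨h1.1.2.1.trans h1.1.2.2.1, h1.2.2.1.trans h1.2.1.symm,
      fun u hu => h1.2.1.trans_lt (h1.2.2.2 u hu)⟩, h1.1.2.1, h1.1.2.2.1⟩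

lemma Ultrafilter.exists_tendsto_isBalancedWave {ι : Type*} (𝒰 : Ultrafilter ι) {f : ℝ → ℝ}
    (hf : IsMonotoneFlux f) {s uL uR : ι → ℝ} {s' uL' uR' u₀ : ℝ} {V : ι → ℝ → ℝ}
    (h : ∀ᶠ i in (𝒰 : Filter ι), IsBalancedWave f (s i) (uL i) (uR i) u₀ (V i))
    (hs : Tendsto s 𝒰 (𝓝 s')) (hL : Tendsto uL 𝒰 (𝓝 uL')) (hR : Tendsto uR 𝒰 (𝓝 uR')) :
    ∃ U, IsBalancedWave f s' uL' uR' u₀ U ∧ ∀ x, Tendsto (fun i => V i x) 𝒰 (𝓝 (U x)) := by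
  have hlim : ∀ x, ∃ w, Tendsto (fun i => V i x) 𝒰 (𝓝 w) := fun x => by
    refine 𝒰.exists_tendsto_of_eventually_mem_Icc (a := uL' - 1) (b := uR' + 1) ?_
    filter_upwards [h, hL.eventually_const_lt (sub_one_lt uL'),
      hR.eventually_lt_const (lt_add_one uR')] with i hi h1 h2
    exact ⟨h1.le.trans (hi.lower x), (hi.upper x).trans h2.le⟩
  choose U hU using hlim
  exact ⟨U, isBalancedWave_of_tendsto hf h hs hL hR hU, hU⟩

/-- Irrational speeds approach `s`, and nearby shocks carry their waves to a limit. -/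
lemma exists_isBalancedWave {f : ℝ → ℝ} (hf : IsMonotoneFlux f) {s : ℝ} (hs : |s| < 1)
    {uL uR u₀ : ℝ} (hsh : IncreasingShock f s uL uR) (hL : uL < u₀) (hR : u₀ < uR) :
    ∃ U, IsBalancedWave f s uL uR u₀ U := by
  obtain ⟨l, r, hl, hr, hlr⟩ := hsh.exists_nearby hf.cont hL hR
  have hne : (𝓝[{x | Irrational x}] s).NeBot :=
    mem_closure_iff_nhdsWithin_neBot.1 (dense_irrational s)
  let 𝒰 : Ultrafilter ℝ := Ultrafilter.of (𝓝[{x | Irrational x}] s)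
  have h𝒰 : (𝒰 : Filter ℝ) ≤ 𝓝[{x | Irrational x}] s := Ultrafilter.of_le _
  have h𝒰' : (𝒰 : Filter ℝ) ≤ 𝓝 s := h𝒰.trans nhdsWithin_le_nhds
  have hex : ∀ᶠ t in (𝒰 : Filter ℝ), ∃ U, IsBalancedWave f t (l t) (r t) u₀ U := by
    have habs : ∀ᶠ t in 𝓝 s, |t| < 1 := (continuous_abs.tendsto s).eventually_lt_const hs
    filter_upwards [h𝒰 self_mem_nhdsWithin, h𝒰' hlr, h𝒰' habs] with t h1 h2 h3
    exact exists_isBalancedWave_of_irrational hf h3 h1 h2.1 h2.2.1 h2.2.2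
  obtain ⟨V, hV⟩ := hex.choice
  obtain ⟨U, hU, -⟩ := 𝒰.exists_tendsto_isBalancedWave hf hV h𝒰' (hl.mono_left h𝒰')
    (hr.mono_left h𝒰')
  exact ⟨U, hU⟩

/-! ### Scalar profiles of speeds `1/2` and `λ_k` -/

lemma speedGap_eq (k : ℕ) : speedGap k = 1 / (4 * k + 2) := by
  have h : (0 : ℝ) < 2 * k + 1 := by positivity
  have : speed k - 1 / 2 = -(1 / (4 * k + 2)) := by
    unfold speed; field_simp; ring
  rw [speedGap, this, abs_neg, abs_of_pos (by positivity)]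

lemma tendsto_speedGap : Tendsto speedGap atTop (𝓝 0) := by
  have h : Tendsto (fun k : ℕ => (4 * (k : ℝ) + 2)) atTop atTop :=
    tendsto_atTop_add_const_right _ _ (tendsto_natCast_atTop_atTop.const_mul_atTop four_pos)
  refine (tendsto_inv_atTop_zero.comp h).congr fun k => ?_
  rw [speedGap_eq, Function.comp_apply, one_div]

lemma tendsto_speed : Tendsto speed atTop (𝓝 (1 / 2)) := by
  have h := (tendsto_zero_iff_abs_tendsto_zero fun k => speed k - 1 / 2).2 tendsto_speedGap
  exact tendsto_sub_nhds_zero_iff.1 h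

lemma speed_eq_div (k : ℕ) : speed k = ((k : ℕ) : ℝ) / ((2 * k + 1 : ℕ) : ℝ) := by
  unfold speed; push_cast; ring

lemma IsBalancedWave.isScalarProfile {f : ℝ → ℝ} (hf : IsMonotoneFlux f) {s uL uR u₀ : ℝ}
    {p q : ℕ} (hs : s = p / q) (hpq : p < q) {U : ℝ → ℝ} (hU : IsBalancedWave f s uL uR u₀ U)
    (hsh : IncreasingShock f s uL uR) (hL : uL < u₀) (hR : u₀ < uR) :
    IsScalarProfile f s uL uR U := by
  refine ⟨fun x => ?_, hU.tendsto_atBot hf hsh hR, hU.tendsto_atTop hf hsh hL, Or.inl ?_⟩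
  · have := hU.wave (x - s)
    rw [WaveAt, show x - s - (1 - s) = x - 1 by ring, show x - s + (1 + s) = x + 1 by ring] at this
    rw [this, plusFlux, minusFlux]
    ring
  · subst hs
    exact hU.strictMono hf hpq hsh hL hR

lemma IsBalancedWave.lipschitzWith {f : ℝ → ℝ} {s uL uR u₀ : ℝ} {U : ℝ → ℝ}
    (hU : IsBalancedWave f s uL uR u₀ U) {L : NNReal} (hL : (uR - uL) / 2 ≤ L) :
    LipschitzWith L U := by
  refine LipschitzWith.of_dist_le_mul fun x y => ?_
  rw [Real.dist_eq, Real.dist_eq]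
  exact (hU.abs_sub_le y x).trans (mul_le_mul_of_nonneg_right hL (abs_nonneg _))

/-- Otherwise an ultralimit is a balanced wave of speed `p / q` with the value `u₀` both at `y` and
at `0`, against strict monotonicity. -/
lemma exists_uniform_gap {f : ℝ → ℝ} (hf : IsMonotoneFlux f) {s uL uR : ℕ → ℝ}
    {uL' uR' u₀ : ℝ} {p q : ℕ} (hpq : p < q) {V : ℕ → ℝ → ℝ}
    (h : ∀ᶠ i in atTop, IsBalancedWave f (s i) (uL i) (uR i) u₀ (V i))
    (hs : Tendsto s atTop (𝓝 (p / q))) (hL : Tendsto uL atTop (𝓝 uL'))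
    (hR : Tendsto uR atTop (𝓝 uR')) (hsh : IncreasingShock f (p / q) uL' uR')
    (hL0 : uL' < u₀) (hR0 : u₀ < uR') {y : ℝ} (hy : y ≠ 0) :
    ∃ γ > 0, ∀ᶠ i in atTop, γ ≤ |V i y - u₀| := by
  by_contra! hcon
  have hcl : MapClusterPt u₀ atTop fun i => V i y := by
    refine mapClusterPt_iff_frequently.2 fun t ht => ?_
    obtain ⟨γ, hγ, hball⟩ := Metric.mem_nhds_iff.1 ht
    refine (hcon γ hγ).mono fun i hi => hball ?_
    rwa [Metric.mem_ball, Real.dist_eq]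
  obtain ⟨𝒰, h𝒰, hy0⟩ := mapClusterPt_iff_ultrafilter.1 hcl
  obtain ⟨U, hU, hlim⟩ := 𝒰.exists_tendsto_isBalancedWave hf (h𝒰 h) (hs.mono_left h𝒰)
    (hL.mono_left h𝒰) (hR.mono_left h𝒰)
  have heq : U y = U 0 := (tendsto_nhds_unique (hlim y) hy0).trans hU.zero.symm
  exact hy ((hU.strictMono hf hpq hsh hL0 hR0).injective heq)

/-- The conclusions about the scalar profiles, with the ranges of the profiles compared near the
origin. -/
def HasScalarProfiles (f : ℝ → ℝ) (uL uR u₀ : ℝ) : Prop :=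
  ∃ (uLk uRk : ℕ → ℝ) (U : ℝ → ℝ) (Uk : ℕ → ℝ → ℝ) (L : NNReal) (ρ : ℝ),
    Tendsto uLk atTop (𝓝 uL) ∧ Tendsto uRk atTop (𝓝 uR) ∧
    (IsScalarProfile f (1 / 2) uL uR U ∧ LipschitzWith L U ∧ U 0 = u₀) ∧
    (∀ᶠ k in atTop, IsScalarProfile f (speed k) (uLk k) (uRk k) (Uk k) ∧
      LipschitzWith L (Uk k) ∧ Uk k 0 = u₀ ∧
      U '' Set.Icc (-ρ) ρ ⊆ Uk k '' Set.Icc (-(1 / 100)) (1 / 100)) ∧ 0 < ρ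

lemma hasScalarProfiles_of_increasing {f : ℝ → ℝ} (hf : IsMonotoneFlux f) {uL uR u₀ : ℝ}
    (hsh : IncreasingShock f (1 / 2) uL uR) (hL : uL < u₀) (hR : u₀ < uR) :
    HasScalarProfiles f uL uR u₀ := by
  obtain ⟨l, r, hl, hr, hlr⟩ := hsh.exists_nearby hf.cont hL hR
  have hhalf : (1 / 2 : ℝ) = ((1 : ℕ) : ℝ) / ((2 : ℕ) : ℝ) := by norm_num
  have hl' : Tendsto (fun k => l (speed k)) atTop (𝓝 uL) := hl.comp tendsto_speed
  have hr' : Tendsto (fun k => r (speed k)) atTop (𝓝 uR) := hr.comp tendsto_speed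
  obtain ⟨U, hU⟩ := exists_isBalancedWave hf (s := 1 / 2) (by norm_num [abs_of_pos]) hsh hL hR
  have hlr' := tendsto_speed.eventually hlr
  have hex : ∀ᶠ k in atTop, ∃ V, IsBalancedWave f (speed k) (l (speed k)) (r (speed k)) u₀ V := by
    filter_upwards [hlr', (continuous_abs.tendsto _ |>.comp tendsto_speed).eventually_lt_const
      (show |(1 / 2 : ℝ)| < 1 by norm_num [abs_of_pos])] with k h1 h2
    exact exists_isBalancedWave hf h2 h1.1 h1.2.1 h1.2.2
  obtain ⟨V, hV⟩ := hex.choice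
  have hgap := fun y (hy : y ≠ 0) => exists_uniform_gap hf (p := 1) (q := 2) one_lt_two hV
    (by rw [← hhalf]; exact tendsto_speed) hl' hr' (by rw [← hhalf]; exact hsh) hL hR hy
  obtain ⟨γ₁, hγ₁, hg1⟩ := hgap (1 / 100) (by norm_num)
  obtain ⟨γ₂, hγ₂, hg2⟩ := hgap (-(1 / 100)) (by norm_num)
  have hD : 0 < uR - uL := sub_pos.2 hsh.lt
  -- Chosen so that the Lipschitz function `U` stays on `[-ρ, ρ]` within the neighbourhood of `u₀`
  -- that every late `V k` covers on `[-1/100, 1/100]`.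
  set ρ := min γ₁ γ₂ / (uR - uL) with hρ
  have hρ0 : 0 < ρ := div_pos (lt_min hγ₁ hγ₂) hD
  have hUρ : ∀ x ∈ Set.Icc (-ρ) ρ, |U x - u₀| ≤ min γ₁ γ₂ := by
    intro x hx
    have h1 := hU.abs_sub_le 0 x
    rw [hU.zero, sub_zero] at h1
    have h2 : |x| ≤ ρ := abs_le.2 hx
    have h3 : (uR - uL) * ρ = min γ₁ γ₂ := by rw [hρ]; field_simp
    nlinarith [abs_nonneg x]
  refine ⟨fun k => l (speed k), fun k => r (speed k), U, V, (uR - uL).toNNReal, ρ, hl', hr',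
    ⟨hU.isScalarProfile hf hhalf one_lt_two hsh hL hR, hU.lipschitzWith ?_, hU.zero⟩, ?_, hρ0⟩
  · rw [Real.coe_toNNReal _ hD.le]; linarith
  have hlen : ∀ᶠ k in atTop, r (speed k) - l (speed k) < 2 * (uR - uL) :=
    (hr'.sub hl').eventually_lt_const (by linarith)
  filter_upwards [hV, hlr', hg1, hg2, hlen] with k hk h1 h2 h3 h4
  have hLip : LipschitzWith (uR - uL).toNNReal (V k) := hk.lipschitzWith (by
    rw [Real.coe_toNNReal _ hD.le]; linarith)
  refine ⟨hk.isScalarProfile hf (speed_eq_div k) (by omega) h1.1 h1.2.1 h1.2.2, hLip, hk.zero, ?_⟩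
  rintro _ ⟨x, hx, rfl⟩
  refine intermediate_value_Icc (by norm_num) hLip.continuous.continuousOn ?_
  have h5 := abs_le.1 (hUρ x hx)
  have h6 : u₀ ≤ V k (1 / 100) := hk.zero.ge.trans (hk.mono (by norm_num))
  have h7 : V k (-(1 / 100)) ≤ u₀ := (hk.mono (by norm_num)).trans hk.zero.le
  rw [abs_of_nonneg (sub_nonneg.2 h6)] at h2
  rw [abs_of_nonpos (sub_nonpos.2 h7)] at h3
  constructor
  · linarith [min_le_right γ₁ γ₂]
  · linarith [min_le_left γ₁ γ₂]

lemma IsScalarProfile.neg {f : ℝ → ℝ} {s uL uR : ℝ} {U : ℝ → ℝ}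
    (h : IsScalarProfile (fun u => -f (-u)) s (-uL) (-uR) U) :
    IsScalarProfile f s uL uR fun x => -U x := by
  refine ⟨fun x => ?_, ?_, ?_, ?_⟩
  · have := h.wave x
    simp only at this ⊢
    linarith
  · simpa using h.left.neg
  · simpa using h.right.neg
  · rcases h.strict with h | h
    · exact Or.inr h.neg
    · exact Or.inl h.neg

/-- The sign change of `u` reduces decreasing shocks to increasing ones. -/
lemma HasScalarProfiles.neg {f : ℝ → ℝ} {uL uR u₀ : ℝ}
    (h : HasScalarProfiles (fun u => -f (-u)) (-uL) (-uR) (-u₀)) :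
    HasScalarProfiles f uL uR u₀ := by
  obtain ⟨uLk, uRk, U, Uk, L, ρ, h1, h2, ⟨h3, h4, h5⟩, h6, h7⟩ := h
  refine ⟨fun k => -uLk k, fun k => -uRk k, fun x => -U x, fun k x => -Uk k x, L, ρ,
    by simpa using h1.neg, by simpa using h2.neg, ⟨h3.neg, h4.neg, by simp [h5]⟩, ?_, h7⟩
  filter_upwards [h6] with k ⟨k1, k2, k3, k4⟩
  refine ⟨IsScalarProfile.neg (by simpa using k1), k2.neg, by simp [k3], ?_⟩
  rintro _ ⟨x, hx, rfl⟩
  obtain ⟨y, hy, hxy⟩ := k4 ⟨x, hx, rfl⟩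
  exact ⟨y, hy, by simp only [hxy]⟩

lemma hasScalarProfiles {f : ℝ → ℝ} (hf : ContDiff ℝ 1 f) (hd : ∀ u, |deriv f u| < 1)
    {uL uR u₀ : ℝ} (hsh : IsStrictShock f (1 / 2) uL uR) (hu : u₀ ∈ Set.uIoo uL uR) :
    HasScalarProfiles f uL uR u₀ := by
  rcases lt_or_gt_of_ne hsh.ne with hlt | hlt
  · rw [Set.uIoo_of_lt hlt] at hu
    refine hasScalarProfiles_of_increasing (isMonotoneFlux_of_deriv hf hd) ⟨hlt, ?_, fun u h => ?_⟩
      hu.1 hu.2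
    · linarith [hsh.rankineHugoniot]
    · have := hsh.oleinik u (by rwa [Set.uIoo_of_lt hlt])
      linarith [pos_of_mul_pos_left this (sub_pos.2 hlt).le]
  · rw [Set.uIoo_of_gt hlt] at hu
    have hf' : IsMonotoneFlux fun u => -f (-u) := by
      refine isMonotoneFlux_of_deriv (contDiff_neg.comp (hf.comp contDiff_neg)) fun u => ?_
      have h1 : HasDerivAt (fun u => -f (-u)) (-(deriv f (-u) * -1)) u :=
        (((hf.differentiable one_ne_zero (-u)).hasDerivAt).comp u (hasDerivAt_neg u)).neg
      rw [h1.deriv]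
      simpa using hd (-u)
    refine HasScalarProfiles.neg (hasScalarProfiles_of_increasing hf'
      ⟨neg_lt_neg hlt, ?_, fun u h => ?_⟩ (neg_lt_neg hu.2) (neg_lt_neg hu.1))
    · simp only [neg_neg]; linarith [hsh.rankineHugoniot]
    · have h1 : -u ∈ Set.Ioo uR uL := ⟨by linarith [h.2], by linarith [h.1]⟩
      have := hsh.oleinik (-u) (by rwa [Set.uIoo_of_gt hlt])
      simp only [neg_neg]
      nlinarith

/-! ### Inverting a polynomial of the shift on `ℓ¹` -/

/-- Absolutely summable complex sequences indexed by the integers. -/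
abbrev SummableSeq : Type := lp (fun _ : ℤ => ℂ) 1

lemma memℓp_one_iff {c : ℤ → ℂ} : Memℓp c 1 ↔ Summable fun n => ‖c n‖ := by
  rw [memℓp_gen_iff (by norm_num)]; simp

lemma SummableSeq.summable_norm (c : SummableSeq) : Summable fun n => ‖c n‖ :=
  memℓp_one_iff.1 (lp.memℓp c)

lemma SummableSeq.norm_eq (c : SummableSeq) : ‖c‖ = ∑' n, ‖c n‖ := by
  rw [lp.norm_eq_tsum_rpow (by norm_num)]; simp

/-- Translation of summable sequences. -/
noncomputable def seqShift (m : ℤ) : SummableSeq →L[ℂ] SummableSeq :=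
  LinearMap.mkContinuous
    { toFun := fun c => ⟨fun n => c (n - m), memℓp_one_iff.2
        ((Equiv.subRight m).summable_iff.2 c.summable_norm)⟩
      map_add' := fun c d => by ext n; rfl
      map_smul' := fun a c => by ext n; rfl } 1 fun c => by
    rw [one_mul, SummableSeq.norm_eq, SummableSeq.norm_eq]
    exact ((Equiv.subRight m).tsum_eq fun n => ‖c n‖).le

lemma seqShift_apply (m : ℤ) (c : SummableSeq) (n : ℤ) : seqShift m c n = c (n - m) := rfl

lemma norm_seqShift_le (m : ℤ) : ‖seqShift m‖ ≤ 1 :=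
  LinearMap.mkContinuous_norm_le _ zero_le_one _

lemma seqShift_mul (m k : ℤ) : seqShift m * seqShift k = seqShift (m + k) := by
  ext c n
  rw [mul_apply_eq_comp, seqShift_apply, seqShift_apply, seqShift_apply, sub_sub]

lemma seqShift_zero : seqShift 0 = 1 := by
  ext c n
  rw [seqShift_apply, sub_zero, one_apply_eq_self]

lemma seqShift_pow (n : ℕ) : seqShift 1 ^ n = seqShift n := by
  induction n with
  | zero => simp [seqShift_zero]
  | succ n ih => rw [pow_succ, ih, seqShift_mul, Nat.cast_succ]

/-- The shift and its inverse both have norm at most 1. -/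
lemma norm_eq_one_of_mem_spectrum_seqShift {z : ℂ} (hz : z ∈ spectrum ℂ (seqShift 1)) :
    ‖z‖ = 1 := by
  have hone : ‖(1 : SummableSeq →L[ℂ] SummableSeq)‖ ≤ 1 := ContinuousLinearMap.norm_id_le
  have hb : ∀ (m : ℤ) (w : ℂ), w ∈ spectrum ℂ (seqShift m) → ‖w‖ ≤ 1 := fun m w hw =>
    (spectrum.norm_le_norm_mul_of_mem hw).trans
      (mul_le_one₀ (norm_seqShift_le m) (norm_nonneg _) hone)
  let u : (SummableSeq →L[ℂ] SummableSeq)ˣ :=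
    ⟨seqShift 1, seqShift (-1), by rw [seqShift_mul, add_neg_cancel, seqShift_zero],
      by rw [seqShift_mul, neg_add_cancel, seqShift_zero]⟩
  have hz0 : z ≠ 0 := spectrum.ne_zero_of_mem_of_unit (a := u) hz
  have hinv : z⁻¹ ∈ spectrum ℂ (seqShift (-1)) := by
    have := (spectrum.inv_mem_iff (r := Units.mk0 z hz0) (a := u)).1 hz
    rw [Units.val_inv_eq_inv_val] at this
    exact this
  refine le_antisymm (hb _ _ hz) ?_
  have := hb _ _ hinv
  rw [norm_inv] at this
  exact (inv_le_one₀ (norm_pos_iff.2 hz0)).1 this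

/-- Spectral mapping: `0` is not in the image under `P` of a spectrum contained in the unit circle.
-/
lemma isUnit_aeval_seqShift {P : Polynomial ℂ} (hP : ∀ z : ℂ, ‖z‖ = 1 → P.eval z ≠ 0) :
    IsUnit (Polynomial.aeval (seqShift 1) P) := by
  have : Nontrivial SummableSeq := ⟨lp.single 1 0 1, 0, fun h => by
    have := congrArg (fun c : SummableSeq => c 0) h
    simp at this⟩
  refine spectrum.isUnit_of_zero_notMem ℂ fun h0 => ?_
  rw [spectrum.map_polynomial_aeval] at h0
  obtain ⟨z, hz, hz0⟩ := h0
  exact hP z (norm_eq_one_of_mem_spectrum_seqShift hz) hz0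

/-- Equality in the triangle inequality forces `z ^ m = 1`, then `z ^ l = 1`, and coprime exponents
leave only `z = 1`. -/
lemma eq_one_of_pow_add_one_eq {z : ℂ} (hz : ‖z‖ = 1) {m l : ℕ} (hml : Nat.Coprime m l)
    (h : z ^ m + 1 = 2 * z ^ l) : z = 1 := by
  have h1 : ‖z ^ m + 1‖ = 2 := by rw [h]; simp [hz]
  have hm : z ^ m = 1 := by
    have := parallelogram_law_with_norm ℂ (z ^ m) 1
    rw [h1, norm_pow, hz, norm_one] at this
    have h2 : ‖z ^ m - 1‖ = 0 := (pow_eq_zero_iff two_ne_zero).1 (by rw [one_pow] at this; linarith)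
    exact sub_eq_zero.1 (norm_eq_zero.1 h2)
  have hl : z ^ l = 1 := by
    rw [hm] at h
    linear_combination -h / 2
  exact orderOf_eq_one_iff.1 (Nat.eq_one_of_dvd_coprimes hml (orderOf_dvd_of_pow_eq_one hm)
    (orderOf_dvd_of_pow_eq_one hl))

/-- The kernel expressing the second component of a profile of speed `1 - l / q` through
`g ∘ U`. -/
lemma exists_profile_kernel {q l : ℕ} (hl : l < q) (hcop : Nat.Coprime (2 * q) l) :
    ∃ c : ℤ → ℝ, Summable (fun n => |c n|) ∧
      (∀ n : ℤ, c (n - (2 * q : ℕ)) - 2 * c (n - l) + c n =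
        (if n = (2 * q : ℕ) then 1 else 0) - (if n = 0 then 1 else 0)) ∧
      ∑' n, c n = q / (q - l : ℝ) := by
  set m := 2 * q with hm
  have hlq : (0 : ℝ) < q - l := sub_pos.2 (by exact_mod_cast hl)
  set N : Polynomial ℂ := ∑ i ∈ Finset.range m, Polynomial.X ^ i with hN
  set M : Polynomial ℂ := ∑ i ∈ Finset.range l, Polynomial.X ^ i with hM
  -- The symbol and the source both vanish at `z = 1`. Dividing both by `X - 1` leaves `P`, which
  -- has no zero on the circle.
  set P : Polynomial ℂ := N - 2 * M with hP
  have hNX : N * (Polynomial.X - 1) = Polynomial.X ^ m - 1 := geom_sum_mul _ _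
  have hMX : M * (Polynomial.X - 1) = Polynomial.X ^ l - 1 := geom_sum_mul _ _
  have hPX : P * (Polynomial.X - 1) = Polynomial.X ^ m - 2 * Polynomial.X ^ l + 1 := by
    rw [hP]; linear_combination hNX - 2 * hMX
  have hP1 : P.eval 1 = 2 * (q - l) := by
    simp [hP, hN, hM, hm, Polynomial.eval_finsetSum]; ring
  have hroot : ∀ z : ℂ, ‖z‖ = 1 → P.eval z ≠ 0 := by
    intro z hz h0
    have h1 := congrArg (Polynomial.eval z) hPX
    simp only [Polynomial.eval_mul, h0, zero_mul, Polynomial.eval_add, Polynomial.eval_sub,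
      Polynomial.eval_pow, Polynomial.eval_X, Polynomial.eval_one, Polynomial.eval_ofNat] at h1
    have h2 : z = 1 := eq_one_of_pow_add_one_eq hz hcop (by linear_combination -h1)
    rw [h2, hP1] at h0
    have h3 : ((2 * (q - l) : ℝ) : ℂ) = 0 := by push_cast; exact h0
    have h4 := Complex.ofReal_eq_zero.1 h3
    linarith
  obtain ⟨u, hu⟩ := isUnit_aeval_seqShift hroot
  set e : SummableSeq := lp.single 1 0 1 with he
  have he' : ∀ n : ℤ, e n = if n = 0 then 1 else 0 := fun n => by
    simp only [he, lp.single_apply, Pi.single_apply]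
  set c : SummableSeq := (↑u⁻¹ : SummableSeq →L[ℂ] SummableSeq)
    (Polynomial.aeval (seqShift 1) N e) with hc
  have huc : Polynomial.aeval (seqShift 1) P c = Polynomial.aeval (seqShift 1) N e := by
    rw [hc, ← hu, ← mul_apply_eq_comp, u.mul_inv, one_apply_eq_self]
  clear_value c e
  have hgeom : ∀ (d : SummableSeq) (r : ℕ) (n : ℤ),
      Polynomial.aeval (seqShift 1) (∑ i ∈ Finset.range r, Polynomial.X ^ i : Polynomial ℂ) d n =
        ∑ i ∈ Finset.range r, d (n - i) := by
    intro d r n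
    simp only [map_sum, map_pow, Polynomial.aeval_X, seqShift_pow]
    induction r with
    | zero => simp
    | succ r ih =>
      rw [Finset.sum_range_succ, Finset.sum_range_succ, add_apply,
        lp.coeFn_add, Pi.add_apply, ih, seqShift_apply]
  have hrel : ∀ n : ℤ, c (n - m) - 2 * c (n - l) + c n = e (n - m) - e n := by
    intro n
    have h1 := congrArg (Polynomial.aeval (seqShift 1) (Polynomial.X - 1 : Polynomial ℂ)) huc
    rw [← mul_apply_eq_comp, ← mul_apply_eq_comp, ← map_mul, ← map_mul,
      mul_comm _ P, mul_comm _ N, hPX, hNX] at h1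
    have h2 := congrArg (fun d : SummableSeq => d n) h1
    simp only [map_sub, map_add, map_pow, Polynomial.aeval_X, map_one,
      seqShift_pow, two_mul, add_apply, sub_apply,
      lp.coeFn_add, lp.coeFn_sub, Pi.add_apply, Pi.sub_apply, seqShift_apply,
      one_apply_eq_self] at h2
    rw [← h2]; ring
  have hsum : ∀ (d : SummableSeq) (r : ℕ),
      HasSum (fun n : ℤ => ∑ i ∈ Finset.range r, d (n - i)) (r * ∑' n, d n) := by
    intro d r
    have h1 : ∀ i ∈ Finset.range r, HasSum (fun n : ℤ => d (n - (i : ℕ))) (∑' n, d n) := fun i _ =>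
      ((Equiv.subRight (i : ℤ)).hasSum_iff (f := fun n => d n)).2 d.summable_norm.of_norm.hasSum
    simpa using hasSum_sum h1
  -- The total is read off the divided relation `P c = N e`; the undivided one sums to `0 = 0`.
  have htot : ((m : ℂ) - 2 * l) * ∑' n, c n = m := by
    have h1 : ∀ n : ℤ, (∑ i ∈ Finset.range m, c (n - i)) - 2 * ∑ i ∈ Finset.range l, c (n - i) =
        ∑ i ∈ Finset.range m, e (n - i) := by
      intro n
      rw [← hgeom, ← hgeom, ← hgeom, ← hN, ← hM, ← huc, hP, map_sub, two_mul M, map_add,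
        sub_apply, add_apply, lp.coeFn_sub, lp.coeFn_add,
        Pi.sub_apply, Pi.add_apply, two_mul]
    have h2 := ((hsum c m).sub ((hsum c l).mul_left 2)).unique
      ((hsum e m).congr_fun fun n => h1 n)
    have h3 : ∑' n, e n = 1 := by
      simp only [he', tsum_ite_eq]
    rw [h3] at h2
    linear_combination h2
  have hre : HasSum (fun n => (c n).re) (∑' n, c n).re :=
    Complex.hasSum_re c.summable_norm.of_norm.hasSum
  refine ⟨fun n => (c n).re, ?_, fun n => ?_, ?_⟩
  · exact c.summable_norm.of_nonneg_of_le (fun n => abs_nonneg _) fun n => Complex.abs_re_le_norm _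
  · have := congrArg Complex.re (hrel n)
    simp only [he', sub_eq_zero, Complex.add_re, Complex.sub_re, Complex.mul_re, Complex.re_ofNat, Complex.im_ofNat,
      zero_mul, sub_zero] at this
    rw [this]
    congr 1 <;> split_ifs <;> simp
  · rw [hre.tsum_eq]
    have h1 : ((2 * (q - l) : ℝ) : ℂ) * ∑' n, c n = ((2 * q : ℝ) : ℂ) := by
      rw [← show (m : ℂ) = ((2 * q : ℝ) : ℂ) by rw [hm]; push_cast; ring, ← htot, hm]
      push_cast; ring
    have h2 := congrArg Complex.re h1
    rw [Complex.re_ofReal_mul, Complex.ofReal_re] at h2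
    field_simp
    linarith

/-! ### Construction of the second component -/

lemma boundedVariationOn_tsum_shift {c : ℤ → ℝ} (hc : Summable fun n => |c n|) {h : ℝ → ℝ}
    (hh : BoundedVariationOn h Set.univ) {B : ℝ} (hB : ∀ x, |h x| ≤ B) (τ : ℝ) :
    BoundedVariationOn (fun x => ∑' n : ℤ, c n * h (x + n * τ)) Set.univ := by
  have hs : ∀ x, Summable fun n : ℤ => c n * h (x + n * τ) := fun x => by
    refine Summable.of_norm_bounded (hc.mul_right B) fun n => ?_
    rw [norm_mul, Real.norm_eq_abs, Real.norm_eq_abs]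
    exact mul_le_mul_of_nonneg_left (hB _) (abs_nonneg _)
  have hfin : (∑' n : ℤ, ‖c n‖ₑ) * eVariationOn h Set.univ ≠ ⊤ := by
    refine ENNReal.mul_ne_top ?_ hh
    have : ∀ n, ‖c n‖ₑ = ENNReal.ofReal |c n| := fun n => by
      rw [← Real.norm_eq_abs, ofReal_norm]
    simp only [this]
    exact hc.tsum_ofReal_ne_top
  refine ne_top_of_le_ne_top hfin (iSup_le fun p => ?_)
  have hstep : ∀ a b, edist (∑' n : ℤ, c n * h (a + n * τ)) (∑' n : ℤ, c n * h (b + n * τ)) ≤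
      ∑' n : ℤ, ‖c n‖ₑ * edist (h (a + n * τ)) (h (b + n * τ)) := by
    intro a b
    rw [edist_eq_enorm_sub, ← (hs a).tsum_sub (hs b)]
    refine enorm_tsum_le_tsum_enorm.trans (le_of_eq (tsum_congr fun n => ?_))
    rw [← mul_sub, enorm_mul, edist_eq_enorm_sub]
  calc ∑ i ∈ Finset.range p.1, edist (∑' n : ℤ, c n * h (p.2.1 (i + 1) + n * τ))
        (∑' n : ℤ, c n * h (p.2.1 i + n * τ))
      ≤ ∑ i ∈ Finset.range p.1, ∑' n : ℤ, ‖c n‖ₑ *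
          edist (h (p.2.1 (i + 1) + n * τ)) (h (p.2.1 i + n * τ)) :=
        Finset.sum_le_sum fun i _ => hstep _ _
    _ = ∑' n : ℤ, ∑ i ∈ Finset.range p.1, ‖c n‖ₑ *
          edist (h (p.2.1 (i + 1) + n * τ)) (h (p.2.1 i + n * τ)) :=
        (Summable.tsum_finsetSum fun i _ => ENNReal.summable).symm
    _ ≤ ∑' n : ℤ, ‖c n‖ₑ * eVariationOn h Set.univ := by
        refine ENNReal.tsum_le_tsum fun n => ?_
        rw [← Finset.mul_sum]
        refine mul_le_mul_right ?_ _
        exact eVariationOn.sum_le (f := h) (u := fun i => p.2.1 i + n * τ)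
          (fun i j hij => add_le_add_left (p.2.2.1 hij) _) fun i => Set.mem_univ _
    _ = _ := ENNReal.tsum_mul_right

lemma BoundedVariationOn.sub_const {h : ℝ → ℝ} {s : Set ℝ} (hh : BoundedVariationOn h s) (a : ℝ) :
    BoundedVariationOn (fun x => h x - a) s :=
  (LipschitzWith.of_dist_le_mul (K := 1) (f := fun y : ℝ => y - a)
    fun x y => by simp).comp_boundedVariationOn hh

/-- The kernel is convolved along `(1/q)ℤ` with `h - hR`, which normalizes the right limit to zero.
Its sum `q / (q - l) = 1 / s` gives the left limit. -/
lemma exists_second_component {q l : ℕ} (hl : l < q) (hcop : Nat.Coprime (2 * q) l) {s : ℝ}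
    (hs : s = 1 - l / q) {h : ℝ → ℝ} (hcont : Continuous h)
    (hbv : BoundedVariationOn h Set.univ) {hL hR B : ℝ} (hB : ∀ x, |h x| ≤ B)
    (tL : Tendsto h atBot (𝓝 hL)) (tR : Tendsto h atTop (𝓝 hR)) :
    ∃ V, Continuous V ∧ LaxFriedrichsWave s V h ∧ Tendsto V atBot (𝓝 ((hL - hR) / s)) ∧
      Tendsto V atTop (𝓝 0) ∧ BoundedVariationOn V Set.univ := by
  obtain ⟨c, hc, hrel, htot⟩ := exists_profile_kernel hl hcop
  have hq : (q : ℝ) ≠ 0 := by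
    have : q ≠ 0 := by omega
    exact_mod_cast this
  have hlq : (q - l : ℝ) ≠ 0 := (sub_pos.2 (by exact_mod_cast hl)).ne'
  set k : ℝ → ℝ := fun x => h x - hR with hk
  set C := B + |hR| with hC
  have hkC : ∀ x, |k x| ≤ C := fun x => (abs_sub _ _).trans (add_le_add_left (hB x) _)
  have hbound : ∀ n x, ‖c n * k x‖ ≤ |c n| * C := fun n x => by
    rw [norm_mul, Real.norm_eq_abs, Real.norm_eq_abs]
    exact mul_le_mul_of_nonneg_left (hkC _) (abs_nonneg _)
  have hkcont : Continuous k := hcont.sub continuous_const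
  set V : ℝ → ℝ := fun x => ∑' n : ℤ, c n * k (x + n * (1 / q : ℝ)) with hV
  have hsum : ∀ x, HasSum (fun n : ℤ => c n * k (x + n * (1 / q : ℝ))) (V x) := fun x =>
    (Summable.of_norm_bounded (hc.mul_right C) fun n => hbound n _).hasSum
  have hshift : ∀ (m : ℕ) x, HasSum (fun n : ℤ => c (n - m) * k (x + n * (1 / q : ℝ)))
      (V (x + m / q)) := by
    intro m x
    have := ((Equiv.subRight (m : ℤ)).hasSum_iff
      (f := fun n : ℤ => c n * k (x + m / q + n * (1 / q : ℝ)))).2 (hsum _)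
    refine this.congr_fun fun n => ?_
    simp only [Function.comp_apply, Equiv.subRight_apply]
    congr 2
    push_cast
    ring
  have hlimV : ∀ {F : Filter ℝ} {w : ℝ}, Tendsto k F (𝓝 w) → (∀ a, Tendsto (fun x => x + a) F F) →
      Tendsto V F (𝓝 (∑' n : ℤ, c n * w)) := by
    intro F w hw hF
    refine tendsto_tsum_of_dominated_convergence (hc.mul_right C)
      (fun n => (hw.comp (hF _)).const_mul _) (Eventually.of_forall fun x n => hbound n _)
  refine ⟨V, ?_, fun x => ?_, ?_, ?_, ?_⟩
  · exact continuous_tsum (fun n => by fun_prop) (hc.mul_right C) fun n x => hbound n _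
  · have h1 := ((hshift (2 * q) (x - 1)).sub ((hshift l (x - 1)).mul_left 2)).add (hsum (x - 1))
    have h2 : HasSum (fun n : ℤ => ((if n = (2 * q : ℕ) then 1 else 0) -
        (if n = 0 then 1 else 0)) * k (x - 1 + n * (1 / q : ℝ))) (k (x + 1) - k (x - 1)) := by
      have e1 := hasSum_ite_eq ((2 * q : ℕ) : ℤ) (k (x + 1))
      have e2 := hasSum_ite_eq (0 : ℤ) (k (x - 1))
      refine (e1.sub e2).congr_fun fun n => ?_
      rw [sub_mul]
      congr 1
      · split_ifs with hn
        · rw [hn, one_mul]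
          congr 1
          push_cast
          field_simp
          ring
        · rw [zero_mul]
      · split_ifs with hn
        · simp [hn]
        · rw [zero_mul]
    have h3 := h1.unique (h2.congr_fun fun n => by rw [← hrel]; ring)
    have e1 : x - 1 + ((2 * q : ℕ) : ℝ) / q = x + 1 := by push_cast; field_simp; ring
    have e2 : x - 1 + (l : ℝ) / q = x - s := by rw [hs]; ring
    rw [e1, e2] at h3
    simp only [hk] at h3
    linarith
  · have := hlimV (tL.sub_const hR) fun a => tendsto_atBot_add_const_right _ a tendsto_id
    rw [tsum_mul_right, htot] at this
    convert this using 2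
    rw [hs]
    field_simp
  · have := hlimV (tR.sub_const hR) fun a => tendsto_atTop_add_const_right _ a tendsto_id
    simpa using this
  · exact boundedVariationOn_tsum_shift hc (hbv.sub_const hR) hkC _

lemma BoundedVariationOn.prodMk {u v : ℝ → ℝ} {s : Set ℝ} (hu : BoundedVariationOn u s)
    (hv : BoundedVariationOn v s) : BoundedVariationOn (fun x => (u x, v x)) s := by
  refine ne_top_of_le_ne_top (ENNReal.add_ne_top.2 ⟨hu, hv⟩) (iSup_le fun p => ?_)
  refine le_trans ?_ (add_le_add (eVariationOn.sum_le (n := p.1) p.2.2.1 p.2.2.2)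
    (eVariationOn.sum_le (n := p.1) p.2.2.1 p.2.2.2))
  rw [← Finset.sum_add_distrib]
  refine Finset.sum_le_sum fun i _ => ?_
  rw [Prod.edist_eq]
  exact max_le le_self_add le_add_self

lemma boundedVariationOn_univ_of_monotone_or_antitone {h : ℝ → ℝ} (hm : Monotone h ∨ Antitone h)
    {B : ℝ} (hB : ∀ x, |h x| ≤ B) : BoundedVariationOn h Set.univ := by
  rcases hm with hm | hm
  · exact (hm.monotoneOn _).boundedVariationOn fun x _ => hB x
  · have h1 : BoundedVariationOn (fun x => -h x) Set.univ :=
      (hm.neg.monotoneOn _).boundedVariationOn (C := B) fun x _ => by rw [abs_neg]; exact hB x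
    simpa [Function.comp_def] using LipschitzWith.id.neg.comp_boundedVariationOn h1

/-! ### The resonant frequency near `4π` -/

lemma norm_log_cos_le {z : ℂ} (hz : ‖z‖ ≤ 1 / 10) :
    ‖Complex.log (Complex.cos z)‖ ≤ ‖z‖ ^ 2 ∧ Complex.cos z ≠ 0 := by
  have h0 := norm_nonneg z
  have h1 : ‖Complex.cos z - 1‖ ≤ 3 / 5 * ‖z‖ ^ 2 := by
    have e : Complex.cos z - 1 = (Complex.cos z - (1 - z ^ 2 / 2)) - z ^ 2 / 2 := by ring
    have h2 := Complex.cos_bound (show ‖z‖ ≤ 1 by linarith)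
    have h3 : ‖z ^ 2 / 2‖ = ‖z‖ ^ 2 / 2 := by simp
    rw [e]
    refine (norm_sub_le _ _).trans ?_
    rw [h3]
    nlinarith [pow_le_one₀ (n := 2) h0 (show ‖z‖ ≤ 1 by linarith), sq_nonneg ‖z‖]
  have h2 : ‖Complex.cos z - 1‖ ≤ 1 / 2 := h1.trans (by nlinarith)
  constructor
  · have h3 := Complex.norm_log_one_add_half_le_self h2
    rw [add_sub_cancel] at h3
    nlinarith [sq_nonneg ‖z‖]
  · intro h
    rw [h] at h2
    norm_num at h2

/-- The equation is linear in `ε`, so `ε` is an explicit function `t` of `η` with `t 0 = 0` and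
nonzero derivative there; `t` is therefore open at `0`. -/
lemma exists_small_resonance : ∃ ε₀ > 0, ∀ ε : ℝ, |ε| < ε₀ → ∃ η : ℂ, ‖η‖ ≤ 1 / 10 ∧
    Complex.I * (4 * Real.pi * ε + (1 / 2 + ε) * η) = -Complex.log (Complex.cos η) := by
  have hpi : (4 * Real.pi : ℂ) ≠ 0 := by simp [Real.pi_ne_zero]
  let t : ℂ → ℂ := fun η => (Complex.I * Complex.log (Complex.cos η) - η / 2) / (4 * Real.pi + η)
  have hd : HasStrictDerivAt t (-1 / (8 * Real.pi)) 0 := by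
    have h1 : HasStrictDerivAt (fun η => Complex.log (Complex.cos η))
        (-Complex.sin 0 / Complex.cos 0) 0 :=
      (Complex.hasStrictDerivAt_cos 0).clog (by simp)
    have h2 := ((h1.const_mul Complex.I).sub ((hasStrictDerivAt_id (0 : ℂ)).div_const 2)).div
      ((hasStrictDerivAt_id (0 : ℂ)).const_add (4 * Real.pi : ℂ)) (by simp [hpi])
    refine h2.congr_deriv ?_
    simp
    field_simp
    ring
  have hne : (-1 / (8 * Real.pi) : ℂ) ≠ 0 := by simp [Real.pi_ne_zero]
  have hmap := hd.map_nhds_eq hne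
  have ht0 : t 0 = 0 := by simp [t]
  rw [ht0] at hmap
  have himg : t '' Metric.closedBall 0 (1 / 10) ∈ 𝓝 (0 : ℂ) := by
    rw [← hmap]
    exact image_mem_map (Metric.closedBall_mem_nhds _ (by norm_num))
  obtain ⟨ε₀, hε₀, hball⟩ := Metric.mem_nhds_iff.1 himg
  refine ⟨ε₀, hε₀, fun ε hε => ?_⟩
  obtain ⟨η, hη, hηε⟩ := hball (show (ε : ℂ) ∈ Metric.ball 0 ε₀ by simpa using hε)
  have hη' : ‖η‖ ≤ 1 / 10 := by simpa using hη
  refine ⟨η, hη', ?_⟩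
  have hden : (4 * Real.pi + η : ℂ) ≠ 0 := by
    intro h
    have h1 : ‖(4 * Real.pi : ℂ)‖ = ‖η‖ := by rw [eq_neg_of_add_eq_zero_left h, norm_neg]
    rw [← Complex.ofReal_ofNat, ← Complex.ofReal_mul, Complex.norm_real, Real.norm_eq_abs,
      abs_of_pos (by positivity)] at h1
    linarith [Real.pi_gt_three]
  have h2 : (ε : ℂ) * (4 * Real.pi + η) = Complex.I * Complex.log (Complex.cos η) - η / 2 := by
    rw [← hηε]
    exact div_mul_cancel₀ _ hden
  linear_combination Complex.I * h2 + Complex.log (Complex.cos η) * Complex.I_sq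

/-- Near the frequency `4π` the scheme of speed `1 / 2 + ε` has a complex frequency whose mode is
stationary up to an error of second order. -/
lemma exists_resonance : ∃ ε₀ > 0, ∀ ε : ℝ, |ε| < ε₀ → ∃ ζ : ℂ,
    Complex.exp (Complex.I * ζ * (1 + (1 / 2 + ε))) +
        Complex.exp (-(Complex.I * ζ * (1 - (1 / 2 + ε)))) = 2 ∧
      ζ.im ≤ 0 ∧ -ζ.im ≤ 10000 * ε ^ 2 ∧ ζ ≠ 0 ∧ ‖ζ‖ ≤ 20 ∧
      |ε| ≤ ‖Complex.exp (Complex.I * ζ * (1 + (1 / 2 + ε))) - 1‖ := by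
  obtain ⟨ε₀, hε₀, hres⟩ := exists_small_resonance
  refine ⟨min ε₀ (1 / 10), lt_min hε₀ (by norm_num), fun ε hε => ?_⟩
  obtain ⟨η, hη, heq⟩ := hres ε (hε.trans_le (min_le_left _ _))
  have hε1 : |ε| < 1 / 10 := hε.trans_le (min_le_right _ _)
  obtain ⟨hε2, hε3⟩ := abs_lt.1 hε1
  obtain ⟨hlog, hcos⟩ := norm_log_cos_le hη
  set θ : ℂ := 4 * Real.pi * ε + (1 / 2 + ε) * η with hθ
  have hη0 := norm_nonneg η
  have hθn : ‖θ‖ ≤ ‖η‖ ^ 2 := by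
    rw [← norm_neg (Complex.log _), ← heq, norm_mul, Complex.norm_I, one_mul] at hlog
    exact hlog
  have hcoef : ‖((1 / 2 + ε : ℝ) : ℂ) * η‖ = (1 / 2 + ε) * ‖η‖ := by
    rw [norm_mul, Complex.norm_real, Real.norm_eq_abs, abs_of_pos (by linarith)]
  have hpiε : ‖((4 * Real.pi * ε : ℝ) : ℂ)‖ = 4 * Real.pi * |ε| := by
    rw [Complex.norm_real, Real.norm_eq_abs, abs_mul, abs_of_pos (by positivity)]
  have hθ' : θ = ((4 * Real.pi * ε : ℝ) : ℂ) + ((1 / 2 + ε : ℝ) : ℂ) * η := by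
    rw [hθ]; push_cast; ring
  have hpi3 := Real.pi_gt_three
  have hpi4 := Real.pi_le_four
  have hεa := abs_nonneg ε
  have hup : ‖η‖ ≤ 60 * |ε| := by
    have h1 : ‖((1 / 2 + ε : ℝ) : ℂ) * η‖ ≤ ‖θ‖ + ‖((4 * Real.pi * ε : ℝ) : ℂ)‖ := by
      rw [show ((1 / 2 + ε : ℝ) : ℂ) * η = θ - ((4 * Real.pi * ε : ℝ) : ℂ) by rw [hθ']; ring]
      exact norm_sub_le _ _
    rw [hcoef, hpiε] at h1
    nlinarith
  have hlow : 12 * |ε| ≤ ‖η‖ := by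
    have h1 : ‖((4 * Real.pi * ε : ℝ) : ℂ)‖ ≤ ‖θ‖ + ‖((1 / 2 + ε : ℝ) : ℂ) * η‖ := by
      rw [show ((4 * Real.pi * ε : ℝ) : ℂ) = θ - ((1 / 2 + ε : ℝ) : ℂ) * η by rw [hθ']; ring]
      exact norm_sub_le _ _
    rw [hcoef, hpiε] at h1
    nlinarith
  -- At `ζ = 4π + η` the two exponents are `θ ± η` up to `6π` and `-2π`. The resonance condition
  -- becomes `exp (iθ) * cos η = 1`, the equation already solved.
  have hα : Complex.exp (Complex.I * (4 * Real.pi + η) * (1 + (1 / 2 + ε))) =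
      Complex.exp (Complex.I * (θ + η)) := by
    rw [Complex.exp_eq_exp_iff_exists_int]
    exact ⟨3, by rw [hθ]; push_cast; ring⟩
  have hβ : Complex.exp (-(Complex.I * (4 * Real.pi + η) * (1 - (1 / 2 + ε)))) =
      Complex.exp (Complex.I * (θ - η)) := by
    rw [Complex.exp_eq_exp_iff_exists_int]
    exact ⟨-1, by rw [hθ]; push_cast; ring⟩
  have hsum : Complex.exp (Complex.I * (θ + η)) + Complex.exp (Complex.I * (θ - η)) = 2 := by
    rw [mul_add, mul_sub, heq, Complex.exp_add, sub_eq_add_neg, Complex.exp_add, Complex.exp_neg,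
      Complex.exp_log hcos, ← mul_add, mul_comm Complex.I, ← neg_mul]
    rw [← Complex.two_cos]
    field_simp
  have him : (4 * Real.pi + η : ℂ).im = η.im := by simp
  refine ⟨4 * Real.pi + η, by rw [hα, hβ, hsum], ?_, ?_, ?_, ?_, ?_⟩
  · rw [him]
    by_contra! hpos
    have hsmall : η.im ≤ 1 / 10 := (Complex.im_le_norm η).trans hη
    -- Taking norms in the resonance equation gives this; but for small positive `η.im` the right
    -- side is below 2, its linear term being `-(1 + 2ε) * η.im`.
    have h2 : (2 : ℝ) ≤ Real.exp (-((3 / 2 + ε) * η.im)) + Real.exp ((1 / 2 - ε) * η.im) := by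
      have h3 := norm_add_le
        (Complex.exp (Complex.I * (4 * Real.pi + η) * (1 + (1 / 2 + ε))))
        (Complex.exp (-(Complex.I * (4 * Real.pi + η) * (1 - (1 / 2 + ε)))))
      rw [hα, hβ, hsum, ← hα, ← hβ, Complex.norm_exp, Complex.norm_exp] at h3
      convert h3 using 2
      · simp
      · congr 1; simp; ring
      · congr 1; simp; ring
    have h3 := (abs_le.1 (Real.abs_exp_sub_one_sub_id_le (x := -((3 / 2 + ε) * η.im))
      (abs_le.2 ⟨by nlinarith, by nlinarith⟩))).2
    have h4 := (abs_le.1 (Real.abs_exp_sub_one_sub_id_le (x := (1 / 2 - ε) * η.im)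
      (abs_le.2 ⟨by nlinarith, by nlinarith⟩))).2
    have h5 : 0 < η.im * ((1 + 2 * ε) - ((3 / 2 + ε) ^ 2 + (1 / 2 - ε) ^ 2) * η.im) := by
      refine mul_pos hpos ?_
      nlinarith
    nlinarith
  · rw [him]
    have h1 : |θ.im| ≤ ‖η‖ ^ 2 := (Complex.abs_im_le_norm θ).trans hθn
    have h2 : θ.im = (1 / 2 + ε) * η.im := by rw [hθ', Complex.add_im, Complex.im_ofReal_mul]; simp
    rw [h2] at h1
    -- Since `4πε` is real, `θ.im` is a multiple of `η.im` while `θ = O(‖η‖²)`; hence the damping is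
    -- quadratic in `ε`.
    have h3 : ‖η‖ ^ 2 ≤ 3600 * ε ^ 2 := by
      have := pow_le_pow_left₀ hη0 hup 2
      rw [mul_pow, sq_abs] at this
      linarith
    have h4 := (abs_le.1 h1).1
    by_contra! hcon
    nlinarith [sq_nonneg ε]
  · intro h
    have h1 := congrArg Complex.re h
    have h2 := (abs_le.1 ((Complex.abs_re_le_norm η).trans hη)).1
    simp at h1
    linarith
  · refine (norm_add_le _ _).trans ?_
    have : ‖(4 * Real.pi : ℂ)‖ = 4 * Real.pi := by
      rw [← Complex.ofReal_ofNat, ← Complex.ofReal_mul, Complex.norm_real, Real.norm_eq_abs,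
        abs_of_pos (by positivity)]
    rw [this]; linarith
  · rw [hα]
    set w := Complex.I * (θ + η) with hw
    have hwn : ‖w‖ = ‖θ + η‖ := by rw [hw, norm_mul, Complex.norm_I, one_mul]
    have h1 : ‖w‖ ≤ 11 / 100 := by
      rw [hwn]; exact (norm_add_le _ _).trans (by nlinarith)
    have h2 : 9 / 10 * ‖η‖ ≤ ‖w‖ := by
      have := norm_sub_le (θ + η) θ
      rw [add_sub_cancel_left] at this
      rw [hwn]; nlinarith
    have h3 := Complex.norm_exp_sub_one_sub_id_le (x := w) (by linarith)
    have h4 := norm_sub_le (Complex.exp w - 1) (Complex.exp w - 1 - w)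
    rw [sub_sub_cancel] at h4
    nlinarith [norm_nonneg w]

/-! ### Oscillation forced by the resonant mode -/

lemma tendsto_integral_window {A : ℝ → ℂ} (hA : Tendsto A atTop (𝓝 0)) (a b : ℝ) :
    Tendsto (fun x => ∫ y in (x + a)..(x + b), A y) atTop (𝓝 0) := by
  refine Metric.tendsto_nhds.2 fun ε hε => ?_
  set δ := ε / (|b - a| + 1) with hδ
  have hδ0 : 0 < δ := by positivity
  obtain ⟨N, hN⟩ := eventually_atTop.1 (Metric.tendsto_nhds.1 hA δ hδ0)
  filter_upwards [eventually_ge_atTop (N - min a b)] with x hx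
  rw [dist_zero_right]
  refine (intervalIntegral.norm_integral_le_of_norm_le_const (C := δ) fun y hy => ?_).trans_lt ?_
  · have h1 : min (x + a) (x + b) < y := hy.1
    rw [min_add_add_left] at h1
    have := hN y (by linarith)
    rw [dist_zero_right] at this
    exact this.le
  · rw [add_sub_add_left_eq_sub]
    have h2 : δ * (|b - a| + 1) = ε := by rw [hδ]; field_simp
    linarith

/-- A resonant mode forces a solution of the linear equation for the second component to
oscillate on every window far downstream. -/
lemma oscillation_lower_bound {s : ℝ} (hs0 : 0 < s) (hs1 : s < 1) {ζ : ℂ}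
    (hζ : Complex.exp (Complex.I * ζ * (1 + s)) + Complex.exp (-(Complex.I * ζ * (1 - s))) = 2)
    (him : ζ.im ≤ 0) (hζ0 : ζ ≠ 0) (hζ20 : ‖ζ‖ ≤ 20) {V h : ℝ → ℝ} (hV : Continuous V)
    (hh : Continuous h) (hw : LaxFriedrichsWave s V h) (hVt : Tendsto V atTop (𝓝 0))
    {hL hR ρ : ℝ} (hρ0 : 0 ≤ ρ) (hρ : ρ ≤ 1 / 100) (left : ∀ x ≤ -ρ, h x = hL)
    (right : ∀ x, ρ ≤ x → h x = hR) (hbd : ∀ x, |h x - hR| ≤ |hL - hR|) {x κ : ℝ}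
    (hx : x + (1 + s) ≤ -ρ)
    (hκ : ∀ y ∈ Set.Icc (x - (1 - s)) (x + (1 + s)), |V y - V x| ≤ κ) :
    ‖Complex.exp (Complex.I * ζ * (1 + s)) - 1‖ * |hL - hR| * (3 / 100) ≤
      κ * Real.exp (ζ.im * (x - 2)) := by
  set c : ℂ := -(Complex.I * ζ) with hc
  have hc0 : c ≠ 0 := neg_ne_zero.2 (mul_ne_zero Complex.I_ne_zero hζ0)
  have hcn : ‖c‖ = ‖ζ‖ := by rw [hc, norm_neg, norm_mul, Complex.norm_I, one_mul]
  have hcre : c.re = ζ.im := by simp [hc]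
  set E : ℝ → ℂ := fun y => Complex.exp (c * y) with hE
  set α := Complex.exp (Complex.I * ζ * (1 + s)) with hα
  set β := Complex.exp (-(Complex.I * ζ * (1 - s))) with hβ
  have hEcont : Continuous E := by fun_prop
  have hEn : ∀ y, ‖E y‖ = Real.exp (ζ.im * y) := fun y => by
    rw [hE, Complex.norm_exp, Complex.re_mul_ofReal, hcre]
  have hαn : ‖α‖ = Real.exp (-(ζ.im * (1 + s))) := by
    rw [hα, Complex.norm_exp]; congr 1; simp
  have hβn : ‖β‖ = Real.exp (ζ.im * (1 - s)) := by
    rw [hβ, Complex.norm_exp]; congr 1; simp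
  have hαE : ∀ y : ℝ, α * E (y + (1 + s)) = E y := fun y => by
    simp only [hα, hE, ← Complex.exp_add, hc]; congr 1; push_cast; ring
  have hβE : ∀ y : ℝ, β * E (y - (1 - s)) = E y := fun y => by
    simp only [hβ, hE, ← Complex.exp_add, hc]; congr 1; push_cast; ring
  have hintE : ∀ a b : ℝ, ∫ y in a..b, E y = (E b - E a) / c := fun a b =>
    integral_exp_mul_complex hc0
  set k : ℝ → ℝ := fun y => h y - hR with hk
  set m : ℝ := hL - hR with hm
  have hkcont : Continuous k := hh.sub continuous_const
  have hwave : ∀ y, (V y : ℂ) = ((V (y + (1 + s)) - k (y + (1 + s))) +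
      (V (y - (1 - s)) + k (y - (1 - s)))) / 2 := fun y => by
    have := hw (y + s)
    rw [add_sub_cancel_right, show y + s + 1 = y + (1 + s) by ring,
      show y + s - 1 = y - (1 - s) by ring] at this
    rw [this]; simp only [hk]; push_cast; ring
  set A : ℝ → ℂ := fun y => ((V y : ℂ) - k y) * E y with hA
  set B : ℝ → ℂ := fun y => ((V y : ℂ) + k y) * E y with hB
  set kE : ℝ → ℂ := fun y => (k y : ℂ) * E y with hkE
  have hAc : Continuous A := by fun_prop
  have hBc : Continuous B := by fun_prop
  have hkEc : Continuous kE := by fun_prop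
  have hint : ∀ {p : ℝ → ℂ}, Continuous p → ∀ a b, IntervalIntegrable p MeasureTheory.volume a b :=
    fun hp a b => hp.intervalIntegrable a b
  set Q : ℝ → ℂ := fun x => (α * (∫ y in x..(x + (1 + s)), A y) -
    β * ∫ y in (x - (1 - s))..x, B y) / 2 with hQ
  set K : ℝ → ℂ := fun x => ∫ y in (0 : ℝ)..x, kE y with hK
  -- conservation of the resonant flux
  have hder : ∀ y, HasDerivAt (fun y => Q y - (α - 1) * K y) 0 y := by
    intro y
    have hFA : ∀ z, HasDerivAt (fun z => ∫ y in (0 : ℝ)..z, A y) (A z) z := fun z =>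
      (hAc.integral_hasStrictDerivAt 0 z).hasDerivAt
    have hFB : ∀ z, HasDerivAt (fun z => ∫ y in (0 : ℝ)..z, B y) (B z) z := fun z =>
      (hBc.integral_hasStrictDerivAt 0 z).hasDerivAt
    have hFK : HasDerivAt K (kE y) y := (hkEc.integral_hasStrictDerivAt 0 y).hasDerivAt
    have h1 := (((((hFA (y + (1 + s))).comp_add_const y (1 + s)).sub (hFA y)).const_mul α).sub
      (((hFB y).sub ((hFB (y - (1 - s))).comp_sub_const y (1 - s))).const_mul β)).div_const 2
    have h2 := h1.sub (hFK.const_mul (α - 1))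
    have hval : (α * (A (y + (1 + s)) - A y) - β * (B y - B (y - (1 - s)))) / 2 -
        -- The wave equation is multiplied by `E y`; the relation `α + β = 2` cancels all terms in
        -- `V`, leaving the source with the factor `α - 1`.
        (α - 1) * kE y = 0 := by
      simp only [hA, hB, hkE]
      linear_combination ((V (y + (1 + s)) : ℂ) - k (y + (1 + s))) / 2 * hαE y +
        ((V (y - (1 - s)) : ℂ) + k (y - (1 - s))) / 2 * hβE y - E y * hwave y -
        ((V y : ℂ) + k y) * E y / 2 * hζ
    rw [hval] at h2
    refine h2.congr_of_eventuallyEq (Eventually.of_forall fun z => ?_)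
    simp only [hQ, Pi.sub_apply]
    rw [intervalIntegral.integral_interval_sub_left (hint hAc _ _) (hint hAc _ _),
      intervalIntegral.integral_interval_sub_left (hint hBc _ _) (hint hBc _ _)]
  have hconst : ∀ y, Q y - (α - 1) * K y = Q x - (α - 1) * K x := fun y =>
    is_const_of_deriv_eq_zero (fun z => (hder z).differentiableAt) (fun z => (hder z).deriv) y x
  -- `ζ.im ≤ 0` makes `E` bounded to the right, where `V` tends to zero and `k` vanishes.
  have hQlim : Tendsto Q atTop (𝓝 0) := by
    have hEb : IsBoundedUnder (· ≤ ·) atTop fun y => ‖E y‖ := by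
      refine isBoundedUnder_of_eventually_le (a := 1) ?_
      filter_upwards [eventually_ge_atTop 0] with y hy
      rw [hEn, Real.exp_le_one_iff]
      exact mul_nonpos_of_nonpos_of_nonneg him hy
    have hk0 : Tendsto (fun y => (k y : ℂ)) atTop (𝓝 0) := by
      refine tendsto_const_nhds.congr' ?_
      filter_upwards [eventually_ge_atTop ρ] with y hy
      simp [hk, right y hy]
    have hV0 : Tendsto (fun y => (V y : ℂ)) atTop (𝓝 0) := by
      have := (Complex.continuous_ofReal.tendsto 0).comp hVt
      rwa [Complex.ofReal_zero] at this
    have hA0 : Tendsto A atTop (𝓝 0) := by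
      have := hV0.sub hk0
      rw [sub_zero] at this
      exact this.zero_mul_isBoundedUnder_le hEb
    have hB0 : Tendsto B atTop (𝓝 0) := by
      have := hV0.add hk0
      rw [add_zero] at this
      exact this.zero_mul_isBoundedUnder_le hEb
    have h1 := (((tendsto_integral_window hA0 0 (1 + s)).const_mul α).sub
      ((tendsto_integral_window hB0 (-(1 - s)) 0).const_mul β)).div_const 2
    simpa [hQ, sub_eq_add_neg] using h1
  have hKρ : ∀ y, ρ ≤ y → K y = K ρ := by
    intro y hy
    have h1 := intervalIntegral.integral_add_adjacent_intervals (hint hkEc 0 ρ) (hint hkEc ρ y)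
    have h2 : ∫ z in ρ..y, kE z = 0 := by
      rw [intervalIntegral.integral_congr (g := fun _ => 0)]
      · simp
      · intro z hz
        rw [Set.uIcc_of_le hy] at hz
        simp [hkE, hk, right z hz.1]
    rw [h2, add_zero] at h1
    exact h1.symm
  have hQx : Q x = (α - 1) * (K x - K ρ) := by
    have h1 : Tendsto (fun y => Q y - (α - 1) * K y) atTop (𝓝 (0 - (α - 1) * K ρ)) := by
      refine hQlim.sub (tendsto_const_nhds.congr' ?_)
      filter_upwards [eventually_ge_atTop ρ] with y hy
      rw [hKρ y hy]
    have h2 := tendsto_nhds_unique (tendsto_const_nhds.congr fun y => (hconst y).symm) h1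
    linear_combination h2
  -- splitting off the constant part of the window
  set d : ℝ → ℂ := fun y => ((V y : ℂ) - V x) * E y with hd
  have hdc : Continuous d := by fun_prop
  have hleft : ∀ y ≤ -ρ, k y = m := fun y hy => by simp only [hk, hm, left y hy]
  have hA1 : ∫ y in x..(x + (1 + s)), A y =
      ((V x : ℂ) - m) * ((E (x + (1 + s)) - E x) / c) + ∫ y in x..(x + (1 + s)), d y := by
    rw [← hintE, ← intervalIntegral.integral_const_mul, ← intervalIntegral.integral_add
      (hint (by fun_prop) _ _) (hint hdc _ _)]
    refine intervalIntegral.integral_congr fun y hy => ?_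
    rw [Set.uIcc_of_le (by linarith)] at hy
    simp only [hA, hd, hleft y (hy.2.trans hx)]; ring
  have hB1 : ∫ y in (x - (1 - s))..x, B y =
      ((V x : ℂ) + m) * ((E x - E (x - (1 - s))) / c) + ∫ y in (x - (1 - s))..x, d y := by
    rw [← hintE, ← intervalIntegral.integral_const_mul, ← intervalIntegral.integral_add
      (hint (by fun_prop) _ _) (hint hdc _ _)]
    refine intervalIntegral.integral_congr fun y hy => ?_
    rw [Set.uIcc_of_le (by linarith)] at hy
    simp only [hB, hd, hleft y (by linarith [hy.2])]; ring
  have hK1 : K ρ - K x = m * ((E (-ρ) - E x) / c) + ∫ y in (-ρ)..ρ, kE y := by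
    have h1 := intervalIntegral.integral_add_adjacent_intervals (hint hkEc 0 x) (hint hkEc x ρ)
    have h2 := intervalIntegral.integral_add_adjacent_intervals (hint hkEc x (-ρ))
      (hint hkEc (-ρ) ρ)
    have h3 : ∫ y in x..(-ρ), kE y = m * ((E (-ρ) - E x) / c) := by
      rw [← hintE, ← intervalIntegral.integral_const_mul]
      refine intervalIntegral.integral_congr fun y hy => ?_
      rw [Set.uIcc_of_le (by linarith)] at hy
      simp only [hkE, hleft y hy.2]
    rw [h3] at h2
    simp only [hK]
    linear_combination -h1 - h2
  -- The contribution of the constant `V x` cancels by `α + β = 2`, so only deviations of `V` on the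
  -- window balance the source.
  have hmain : (α * (∫ y in x..(x + (1 + s)), d y) - β * ∫ y in (x - (1 - s))..x, d y) / 2 =
      -(α - 1) * (m * (E (-ρ) / c) + ∫ y in (-ρ)..ρ, kE y) := by
    have h1 := hQx
    simp only [hQ] at h1
    rw [hA1, hB1, ← neg_sub (K ρ), hK1] at h1
    linear_combination h1 - ((V x : ℂ) - m) / (2 * c) * hαE x - ((V x : ℂ) + m) / (2 * c) * hβE x +
      ((V x : ℂ) + m) * E x / (2 * c) * hζ
  have hκ0 : 0 ≤ κ := (abs_nonneg _).trans (hκ x ⟨by linarith, by linarith⟩)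
  have hexp : ∀ {a b : ℝ}, a ≤ b → Real.exp (ζ.im * b) ≤ Real.exp (ζ.im * a) := fun hab =>
    Real.exp_le_exp.2 (mul_le_mul_of_nonpos_left hab him)
  have hdn : ∀ {a y : ℝ}, a ≤ y → y ∈ Set.Icc (x - (1 - s)) (x + (1 + s)) →
      ‖d y‖ ≤ κ * Real.exp (ζ.im * a) := by
    intro a y hay hy
    have : ‖d y‖ = |V y - V x| * Real.exp (ζ.im * y) := by
      simp only [hd]
      rw [norm_mul, hEn, ← Complex.ofReal_sub, Complex.norm_real, Real.norm_eq_abs]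
    rw [this]
    exact mul_le_mul (hκ y hy) (hexp hay) (Real.exp_pos _).le hκ0
  have hb1 : ‖α * ∫ y in x..(x + (1 + s)), d y‖ ≤ κ * (1 + s) * Real.exp (ζ.im * (x - 2)) := by
    have h1 := intervalIntegral.norm_integral_le_of_norm_le_const (f := d) (a := x)
      (b := x + (1 + s)) (C := κ * Real.exp (ζ.im * x)) fun y hy => by
        rw [Set.uIoc_of_le (by linarith)] at hy
        exact hdn hy.1.le ⟨by linarith [hy.1], hy.2⟩
    rw [add_sub_cancel_left, abs_of_pos (by linarith)] at h1
    rw [norm_mul, hαn]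
    refine (mul_le_mul_of_nonneg_left h1 (Real.exp_pos _).le).trans ?_
    have h2 : Real.exp (-(ζ.im * (1 + s))) * Real.exp (ζ.im * x) ≤
        Real.exp (ζ.im * (x - 2)) := by
      rw [← Real.exp_add, show -(ζ.im * (1 + s)) + ζ.im * x = ζ.im * (x - (1 + s)) by ring]
      exact hexp (by linarith)
    calc _ = κ * (1 + s) * (Real.exp (-(ζ.im * (1 + s))) * Real.exp (ζ.im * x)) := by ring
      _ ≤ _ := mul_le_mul_of_nonneg_left h2 (mul_nonneg hκ0 (by linarith))
  have hb2 : ‖β * ∫ y in (x - (1 - s))..x, d y‖ ≤ κ * (1 - s) * Real.exp (ζ.im * (x - 2)) := by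
    have h1 := intervalIntegral.norm_integral_le_of_norm_le_const (f := d) (a := x - (1 - s))
      (b := x) (C := κ * Real.exp (ζ.im * (x - 2))) fun y hy => by
        rw [Set.uIoc_of_le (by linarith)] at hy
        exact hdn (by linarith [hy.1]) ⟨hy.1.le, by linarith [hy.2]⟩
    rw [sub_sub_cancel, abs_of_pos (by linarith)] at h1
    have h2 : Real.exp (ζ.im * (1 - s)) ≤ 1 :=
      Real.exp_le_one_iff.2 (mul_nonpos_of_nonpos_of_nonneg him (by linarith))
    rw [norm_mul, hβn]
    refine (mul_le_of_le_one_left (norm_nonneg _) h2).trans (h1.trans (le_of_eq (by ring)))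
  have hupper : ‖(α * (∫ y in x..(x + (1 + s)), d y) - β * ∫ y in (x - (1 - s))..x, d y) / 2‖ ≤
      κ * Real.exp (ζ.im * (x - 2)) := by
    rw [norm_div, Complex.norm_ofNat]
    have := norm_sub_le (α * ∫ y in x..(x + (1 + s)), d y) (β * ∫ y in (x - (1 - s))..x, d y)
    rw [div_le_iff₀ two_pos]
    linarith
  -- The jump term is at least `1/20` since `‖ζ‖ ≤ 20`, and the transition layer at most `2ρ ≤
  -- 1/50`, in units of `|m| * exp (ζ.im * -ρ)`: the layer is too thin to cancel the mode.
  have hlower : |m| * (3 / 100) ≤ ‖m * (E (-ρ) / c) + ∫ y in (-ρ)..ρ, kE y‖ := by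
    have h1 := intervalIntegral.norm_integral_le_of_norm_le_const (f := kE) (a := -ρ)
      (b := ρ) (C := |m| * Real.exp (ζ.im * -ρ)) fun y hy => by
        rw [Set.uIoc_of_le (by linarith)] at hy
        simp only [hkE]
        rw [norm_mul, hEn, Complex.norm_real, Real.norm_eq_abs]
        exact mul_le_mul (hbd y) (hexp hy.1.le) (Real.exp_pos _).le (abs_nonneg _)
    rw [abs_of_nonneg (show 0 ≤ ρ - -ρ by linarith)] at h1
    have h2 : ‖(m : ℂ) * (E (-ρ) / c)‖ = |m| * Real.exp (ζ.im * -ρ) / ‖ζ‖ := by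
      rw [norm_mul, norm_div, hEn, hcn, Complex.norm_real, Real.norm_eq_abs, mul_div_assoc]
    have h3 : |m| * Real.exp (ζ.im * -ρ) / 20 ≤ |m| * Real.exp (ζ.im * -ρ) / ‖ζ‖ :=
      div_le_div_of_nonneg_left (mul_nonneg (abs_nonneg _) (Real.exp_pos _).le)
        (norm_pos_iff.2 hζ0) hζ20
    have h4 := norm_sub_le (m * (E (-ρ) / c) + ∫ y in (-ρ)..ρ, kE y) (∫ y in (-ρ)..ρ, kE y)
    rw [add_sub_cancel_right, h2] at h4
    have h5 : (1 : ℝ) ≤ Real.exp (ζ.im * -ρ) := Real.one_le_exp (by nlinarith)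
    have h6 : |m| ≤ |m| * Real.exp (ζ.im * -ρ) := le_mul_of_one_le_right (abs_nonneg _) h5
    have h7 : |m| * Real.exp (ζ.im * -ρ) * (ρ - -ρ) ≤ |m| * Real.exp (ζ.im * -ρ) * (1 / 50) :=
      mul_le_mul_of_nonneg_left (by linarith) (mul_nonneg (abs_nonneg _) (Real.exp_pos _).le)
    linarith
  rw [hmain, norm_mul, norm_neg] at hupper
  calc ‖α - 1‖ * |m| * (3 / 100) = ‖α - 1‖ * (|m| * (3 / 100)) := by ring
    _ ≤ _ := mul_le_mul_of_nonneg_left hlower (norm_nonneg _)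
    _ ≤ _ := hupper

/-! ### Variation estimates and the source `g ∘ U` -/

lemma eVariationOn_le_sub_add (u v : ℝ → ℝ) (s : Set ℝ) :
    eVariationOn u s ≤ eVariationOn (fun x => u x - v x) s + eVariationOn v s := by
  refine iSup_le fun p => ?_
  refine le_trans ?_ (add_le_add (eVariationOn.sum_le (n := p.1) p.2.2.1 p.2.2.2)
    (eVariationOn.sum_le (n := p.1) p.2.2.1 p.2.2.2))
  rw [← Finset.sum_add_distrib]
  refine Finset.sum_le_sum fun i _ => ?_
  simp only [edist_dist, Real.dist_eq]
  rw [← ENNReal.ofReal_add (abs_nonneg _) (abs_nonneg _)]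
  refine ENNReal.ofReal_le_ofReal (le_trans (le_of_eq ?_) (abs_add_le _ _))
  congr 1
  ring

lemma eVariationOn_snd_le (u : ℝ → ℝ × ℝ) (s : Set ℝ) :
    eVariationOn (fun x => (u x).2) s ≤ eVariationOn u s := by
  refine iSup_le fun p => le_trans (Finset.sum_le_sum fun i _ => ?_)
    (eVariationOn.sum_le (n := p.1) p.2.2.1 p.2.2.2)
  rw [Prod.edist_eq]
  exact le_max_right _ _

lemma abs_sub_le_of_monotone_or_antitone {h : ℝ → ℝ} (hm : Monotone h ∨ Antitone h) {hL hR : ℝ}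
    (tL : Tendsto h atBot (𝓝 hL)) (tR : Tendsto h atTop (𝓝 hR)) (x : ℝ) :
    |h x - hR| ≤ |hL - hR| := by
  rcases hm with hm | hm
  · have h1 := hm.le_of_tendsto tL x
    have h2 := hm.ge_of_tendsto tR x
    rw [abs_of_nonpos (by linarith), abs_of_nonpos (by linarith)]
    linarith
  · have h1 := hm.ge_of_tendsto tL x
    have h2 := hm.le_of_tendsto tR x
    rw [abs_of_nonneg (by linarith), abs_of_nonneg (by linarith)]
    linarith

lemma abs_le_of_monotone_or_antitone {h : ℝ → ℝ} (hm : Monotone h ∨ Antitone h) {hL hR : ℝ}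
    (tL : Tendsto h atBot (𝓝 hL)) (tR : Tendsto h atTop (𝓝 hR)) (x : ℝ) :
    |h x| ≤ |hL - hR| + |hR| := by
  have h1 := abs_sub_le_of_monotone_or_antitone hm tL tR x
  have h2 := abs_add_le (h x - hR) hR
  rw [sub_add_cancel] at h2
  linarith

lemma comp_monotone_or_antitone {g U : ℝ → ℝ} (hg : Monotone g ∨ Antitone g)
    (hU : StrictMono U ∨ StrictAnti U) :
    Monotone (fun x => g (U x)) ∨ Antitone (fun x => g (U x)) := by
  rcases hg with hg | hg <;> rcases hU with hU | hU
  · exact Or.inl (hg.comp hU.monotone)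
  · exact Or.inr (hg.comp_antitone hU.antitone)
  · exact Or.inr (hg.comp_monotone hU.monotone)
  · exact Or.inl (hg.comp hU.antitone)

lemma mem_Ioo_of_mem_uIoo_apply {U : ℝ → ℝ} (hU : StrictMono U ∨ StrictAnti U) {x y z : ℝ}
    (hxy : x < y) (hz : U z ∈ Set.uIoo (U x) (U y)) : z ∈ Set.Ioo x y := by
  rcases hU with hU | hU
  · rw [Set.uIoo_of_lt (hU hxy)] at hz
    exact ⟨hU.lt_iff_lt.1 hz.1, hU.lt_iff_lt.1 hz.2⟩
  · rw [Set.uIoo_of_gt (hU hxy)] at hz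
    exact ⟨hU.lt_iff_gt.1 hz.2, hU.lt_iff_gt.1 hz.1⟩

lemma exists_deriv_ne_zero_of_ne {g : ℝ → ℝ} (hg : Differentiable ℝ g) {a b : ℝ}
    (hab : g a ≠ g b) : ∃ v ∈ Set.uIoo a b, deriv g v ≠ 0 := by
  wlog h : a < b generalizing a b
  · obtain ⟨v, hv, hd⟩ := this hab.symm
      (lt_of_le_of_ne (not_lt.1 h) fun e => hab (congrArg g e.symm))
    exact ⟨v, Set.uIoo_comm a b ▸ hv, hd⟩
  obtain ⟨v, hv, hd⟩ := exists_deriv_eq_slope g h hg.continuous.continuousOn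
    hg.differentiableOn
  refine ⟨v, by rwa [Set.uIoo_of_lt h], ?_⟩
  rw [hd]
  exact div_ne_zero (sub_ne_zero.2 hab.symm) (sub_pos.2 h).ne'

/-- By the mean value theorem, a change of `g` between `U x` and `U y` needs a point of `A` strictly
between `x` and `y`. -/
lemma comp_eq_of_deriv_supported {g U : ℝ → ℝ} (hg : Differentiable ℝ g)
    (hU : StrictMono U ∨ StrictAnti U) {A : Set ℝ} (hsupp : ∀ u, deriv g u ≠ 0 → u ∈ U '' A)
    {x y : ℝ} (hxy : x < y) (hA : ∀ z ∈ A, z ∉ Set.Ioo x y) : g (U x) = g (U y) := by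
  by_contra h
  obtain ⟨v, hv, hd⟩ := exists_deriv_ne_zero_of_ne hg h
  obtain ⟨z, hz, rfl⟩ := hsupp v hd
  exact hA z hz (mem_Ioo_of_mem_uIoo_apply hU hxy hv)

lemma comp_eq_left_of_deriv_supported {g U : ℝ → ℝ} (hg : Differentiable ℝ g)
    (hU : StrictMono U ∨ StrictAnti U) {ρ : ℝ}
    (hsupp : ∀ u, deriv g u ≠ 0 → u ∈ U '' Set.Icc (-ρ) ρ) {uL : ℝ}
    (tL : Tendsto U atBot (𝓝 uL)) {x : ℝ} (hx : x ≤ -ρ) : g (U x) = g uL := by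
  refine tendsto_nhds_unique (tendsto_const_nhds.congr' ?_)
    ((hg.continuous.tendsto uL).comp tL)
  filter_upwards [eventually_lt_atBot x] with y hy
  exact (comp_eq_of_deriv_supported hg hU hsupp hy fun z hz h =>
    absurd h.2 (not_lt.2 (hx.trans hz.1))).symm

lemma comp_eq_right_of_deriv_supported {g U : ℝ → ℝ} (hg : Differentiable ℝ g)
    (hU : StrictMono U ∨ StrictAnti U) {ρ : ℝ}
    (hsupp : ∀ u, deriv g u ≠ 0 → u ∈ U '' Set.Icc (-ρ) ρ) {uR : ℝ}
    (tR : Tendsto U atTop (𝓝 uR)) {x : ℝ} (hx : ρ ≤ x) : g (U x) = g uR := by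
  refine tendsto_nhds_unique (tendsto_const_nhds.congr' ?_)
    ((hg.continuous.tendsto uR).comp tR)
  filter_upwards [eventually_gt_atTop x] with y hy
  exact comp_eq_of_deriv_supported hg hU hsupp hy fun z hz h =>
    absurd h.1 (not_lt.2 (hz.2.trans hx))

/-- If the end values agreed, monotonicity would make `g ∘ U` constant, and `g` constant near `U z`.
-/
lemma limits_ne_of_deriv_ne_zero {g U : ℝ → ℝ} (hg : Differentiable ℝ g)
    (hm : Monotone g ∨ Antitone g) (hUc : Continuous U) (hU : StrictMono U ∨ StrictAnti U)
    {uL uR : ℝ} (tL : Tendsto U atBot (𝓝 uL)) (tR : Tendsto U atTop (𝓝 uR)) {z : ℝ}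
    (hz : deriv g (U z) ≠ 0) : g uL ≠ g uR := by
  intro h
  have hconst : ∀ x, g (U x) = g uR := fun x => by
    have := abs_sub_le_of_monotone_or_antitone (comp_monotone_or_antitone hm hU)
      ((hg.continuous.tendsto uL).comp tL) ((hg.continuous.tendsto uR).comp tR) x
    rw [h, sub_self, abs_zero] at this
    exact sub_eq_zero.1 (abs_nonpos_iff.1 this)
  have hnhds : Set.uIcc (U (z - 1)) (U (z + 1)) ∈ 𝓝 (U z) := by
    rcases hU with hU | hU
    · have h1 : U (z - 1) < U z := hU (by linarith)
      have h2 : U z < U (z + 1) := hU (by linarith)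
      rw [Set.uIcc_of_le (h1.trans h2).le]
      exact Icc_mem_nhds h1 h2
    · have h1 : U z < U (z - 1) := hU (by linarith)
      have h2 : U (z + 1) < U z := hU (by linarith)
      rw [Set.uIcc_of_ge (h2.trans h1).le]
      exact Icc_mem_nhds h2 h1
  have hev : g =ᶠ[𝓝 (U z)] fun _ => g uR := by
    filter_upwards [hnhds] with u hu
    obtain ⟨x, -, rfl⟩ := intermediate_value_uIcc hUc.continuousOn hu
    exact hconst x
  exact hz (by rw [hev.deriv_eq, deriv_const])

/-! ### Profiles of the triangular system -/

lemma IsScalarProfile.exists_system {f U : ℝ → ℝ} {s uL uR : ℝ} (hU : IsScalarProfile f s uL uR U)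
    (hUc : Continuous U) {g : ℝ → ℝ} (hg : Continuous g) (hm : Monotone g ∨ Antitone g)
    {q l : ℕ} (hl : l < q) (hcop : Nat.Coprime (2 * q) l) (hs : s = 1 - l / q) :
    ∃ V, Continuous V ∧ Tendsto V atTop (𝓝 0) ∧ BoundedVariationOn V Set.univ ∧
      IsSystemProfile f g s (uL, (g uL - g uR) / s) (uR, 0) (fun x => (U x, V x)) := by
  have tL : Tendsto (fun x => g (U x)) atBot (𝓝 (g uL)) := (hg.tendsto uL).comp hU.left
  have tR : Tendsto (fun x => g (U x)) atTop (𝓝 (g uR)) := (hg.tendsto uR).comp hU.right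
  have hm' := comp_monotone_or_antitone hm hU.strict
  have hB := abs_le_of_monotone_or_antitone hm' tL tR
  obtain ⟨V, hVc, hw, hVL, hVR, hbv⟩ := exists_second_component hl hcop hs (hg.comp hUc)
    (boundedVariationOn_univ_of_monotone_or_antitone hm' hB) hB tL tR
  have hUm := hU.strict.imp StrictMono.monotone StrictAnti.antitone
  exact ⟨V, hVc, hVR, hbv, hU.wave, hw, hU.left.prodMk_nhds hVL, hU.right.prodMk_nhds hVR,
    (boundedVariationOn_univ_of_monotone_or_antitone hUm
      (abs_le_of_monotone_or_antitone hUm hU.left hU.right)).prodMk hbv⟩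

/-- Here `q = 2k + 1` and `l = k + 1`. For even `k` the number `l` is odd, hence coprime to `2q`;
for odd `k` both would be even. -/
lemma IsScalarProfile.exists_system_speed {f U : ℝ → ℝ} {k : ℕ} {uL uR : ℝ}
    (hU : IsScalarProfile f (speed k) uL uR U) (hUc : Continuous U) {g : ℝ → ℝ}
    (hg : Continuous g) (hm : Monotone g ∨ Antitone g) (hk : Even k) (hk0 : 0 < k) :
    ∃ V, Continuous V ∧ Tendsto V atTop (𝓝 0) ∧ BoundedVariationOn V Set.univ ∧
      IsSystemProfile f g (speed k) (uL, (g uL - g uR) / speed k) (uR, 0)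
        (fun x => (U x, V x)) := by
  refine hU.exists_system hUc hg hm (q := 2 * k + 1) (l := k + 1) (by omega) ?_ ?_
  · refine Nat.Coprime.mul_left ?_ ?_
    · exact (Nat.coprime_two_left).2 hk.add_one
    · have h : Nat.Coprime (2 * (k + 1) - 1) (k + 1) := by
        rw [Nat.coprime_iff_gcd_eq_one]
        have := Nat.gcd_dvd (2 * k + 1) (k + 1)
        have h1 : Nat.gcd (2 * k + 1) (k + 1) ∣ 1 := by
          have h2 : Nat.gcd (2 * k + 1) (k + 1) ∣ 2 * (k + 1) := this.2.mul_left 2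
          have h3 := (Nat.dvd_add_right this.1).1 (show _ ∣ (2 * k + 1) + 1 from h2)
          exact h3
        exact Nat.dvd_one.1 h1
      exact h
  · have : (2 * (k : ℝ) + 1) ≠ 0 := by positivity
    rw [speed]
    push_cast
    field_simp
    ring

/-! ### Variation far downstream -/

/-- Each window of length 2 in `[-2T, -T]` contributes at least a constant times `|s - 1/2| * |hL -
hR|`, since `T * |s - 1/2|² ≤ 1` keeps the damping bounded. -/
lemma exists_variation_lower_bound : ∃ ε₀ > 0, ∀ s : ℝ, 0 < s → s < 1 → |s - 1 / 2| < ε₀ →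
    |s - 1 / 2| ≤ 1 → ∀ V h : ℝ → ℝ, Continuous V → Continuous h → LaxFriedrichsWave s V h →
    Tendsto V atTop (𝓝 0) → BoundedVariationOn V Set.univ → ∀ hL hR : ℝ,
    (∀ x ≤ -(1 / 100), h x = hL) → (∀ x, 1 / 100 ≤ x → h x = hR) →
    (∀ x, |h x - hR| ≤ |hL - hR|) → ∀ T : ℝ, 1 ≤ T → T * |s - 1 / 2| ^ 2 ≤ 1 →
    ENNReal.ofReal ((T / 2 - 1) * (|s - 1 / 2| * |hL - hR| * (3 / 100) * Real.exp (-40000))) ≤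
      eVariationOn V (Set.Icc (-(2 * T)) (-(1 * T))) := by
  obtain ⟨ε₀, hε₀, H⟩ := exists_resonance
  refine ⟨ε₀, hε₀, fun s hs0 hs1 hsε hsε1 V h hV hh hw hVt hbv hL hR left right hbd T hT hTε => ?_⟩
  obtain ⟨ζ, hζ, him, him', hζ0, hζ20, hlow⟩ := H (s - 1 / 2) hsε
  have hcast : (1 / 2 + ((s - 1 / 2 : ℝ) : ℂ)) = s := by push_cast; ring
  rw [hcast] at hζ hlow
  set K := |s - 1 / 2| * |hL - hR| * (3 / 100) * Real.exp (-40000) with hK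
  have hK0 : 0 ≤ K := by positivity
  have hblock : ∀ a : ℝ, -(2 * T) ≤ a → a + 2 ≤ -T →
      ENNReal.ofReal K ≤ eVariationOn V (Set.Icc a (a + 2)) := by
    intro a ha ha'
    have hbva := hbv.mono (Set.subset_univ (Set.Icc a (a + 2)))
    set κ := (eVariationOn V (Set.Icc a (a + 2))).toReal with hκ
    have hκ0 : 0 ≤ κ := ENNReal.toReal_nonneg
    have key := oscillation_lower_bound hs0 hs1 hζ him hζ0 hζ20 hV hh hw hVt
      (by norm_num : (0 : ℝ) ≤ 1 / 100) le_rfl left right hbd (x := a + (1 - s)) (κ := κ)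
      (by linarith) (by
        intro y hy
        rw [← Real.dist_eq]
        exact hbva.dist_le ⟨by linarith [hy.1], by linarith [hy.2]⟩
          ⟨by linarith, by linarith⟩)
    -- The damping rate is at most `10000 * (s - 1/2)²`, and the distance is at most `4T` because `T
    -- ≥ 1`.
    have hexp : ζ.im * (a + (1 - s) - 2) ≤ 40000 := by
      have h1 : -ζ.im * (2 - (a + (1 - s))) ≤ 10000 * (s - 1 / 2) ^ 2 * (4 * T) :=
        mul_le_mul him' (by linarith) (by linarith) (by positivity)
      rw [← sq_abs] at h1
      linarith
    have h2 : κ * Real.exp (ζ.im * (a + (1 - s) - 2)) ≤ κ * Real.exp 40000 :=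
      mul_le_mul_of_nonneg_left (Real.exp_le_exp.2 hexp) hκ0
    have h3 : |s - 1 / 2| * |hL - hR| * (3 / 100) ≤
        ‖Complex.exp (Complex.I * ζ * (1 + s)) - 1‖ * |hL - hR| * (3 / 100) := by gcongr
    have h4 : K ≤ κ := by
      rw [hK, Real.exp_neg, ← div_eq_mul_inv, div_le_iff₀ (Real.exp_pos _)]
      linarith
    rw [← ENNReal.ofReal_toReal hbva]
    exact ENNReal.ofReal_le_ofReal h4
  set n := ⌊T / 2⌋₊ with hn
  have hn1 : (n : ℝ) ≤ T / 2 := Nat.floor_le (by linarith)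
  have hn2 : T / 2 - 1 ≤ n := by linarith [Nat.lt_floor_add_one (T / 2)]
  set I : ℕ → ℝ := fun i => -T - 2 * n + 2 * i with hI
  have hImono : Monotone I := fun i j hij => by
    have : (i : ℝ) ≤ j := by exact_mod_cast hij
    simp only [hI]
    linarith
  calc ENNReal.ofReal ((T / 2 - 1) * K) ≤ ENNReal.ofReal (n * K) :=
        ENNReal.ofReal_le_ofReal (mul_le_mul_of_nonneg_right hn2 hK0)
    _ = ∑ i ∈ Finset.range n, ENNReal.ofReal K := by
        rw [Finset.sum_const, Finset.card_range, nsmul_eq_mul,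
          ENNReal.ofReal_mul (Nat.cast_nonneg n), ENNReal.ofReal_natCast]
    _ ≤ ∑ i ∈ Finset.range n, eVariationOn V (Set.Icc (I i) (I (i + 1))) := by
        refine Finset.sum_le_sum fun i hi => ?_
        have hi' : (i : ℝ) + 1 ≤ n := by exact_mod_cast Finset.mem_range.1 hi
        have hi0 : (0 : ℝ) ≤ i := Nat.cast_nonneg i
        have : I (i + 1) = I i + 2 := by simp only [hI]; push_cast; ring
        rw [this]
        exact hblock _ (by simp only [hI]; linarith) (by simp only [hI]; linarith)
    _ = eVariationOn V (Set.Icc (I 0) (I n)) := eVariationOn.sum' V hImono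
    _ ≤ _ := eVariationOn.mono _ (Set.Icc_subset_Icc (by simp only [hI]; push_cast; linarith)
        (by simp only [hI]; linarith))

/-- The exponent `-2 / (1 + 2δ) + 1` is negative exactly because `δ < 1/2`. -/
lemma tendsto_mul_rpow_speedGap {δ : ℝ} (hδ0 : 0 < δ) (hδ : δ < 1 / 2) :
    Tendsto (fun k => speedGap k ^ (-2 / (1 + 2 * δ)) * speedGap k) atTop atTop := by
  have hpos : ∀ k, 0 < speedGap k := fun k => by rw [speedGap_eq]; positivity
  have h0 : Tendsto speedGap atTop (𝓝[>] 0) :=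
    tendsto_nhdsWithin_iff.2 ⟨tendsto_speedGap, Eventually.of_forall hpos⟩
  have hexp : -2 / (1 + 2 * δ) + 1 < 0 := by
    rw [div_add_one (by linarith)]
    exact div_neg_of_neg_of_pos (by linarith) (by linarith)
  refine ((tendsto_rpow_neg_nhdsGT_zero hexp).comp h0).congr fun k => ?_
  simp only [Function.comp]
  rw [Real.rpow_add_one (hpos k).ne']

lemma rpow_speedGap_bounds {δ : ℝ} (hδ0 : 0 < δ) (k : ℕ) :
    1 ≤ speedGap k ^ (-2 / (1 + 2 * δ)) ∧
      speedGap k ^ (-2 / (1 + 2 * δ)) * speedGap k ^ 2 ≤ 1 := by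
  have hpos : 0 < speedGap k := by rw [speedGap_eq]; positivity
  have hle : speedGap k ≤ 1 := by
    rw [speedGap_eq, div_le_one (by positivity)]
    linarith [Nat.cast_nonneg (α := ℝ) k]
  have hden : 0 < 1 + 2 * δ := by linarith
  refine ⟨Real.one_le_rpow_of_pos_of_le_one_of_nonpos hpos hle
    (div_nonpos_of_nonpos_of_nonneg (by norm_num) hden.le), ?_⟩
  rw [← Real.rpow_natCast (speedGap k) 2, ← Real.rpow_add hpos]
  refine Real.rpow_le_one hpos.le hle ?_
  push_cast
  rw [div_add' _ _ _ hden.ne']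
  exact div_nonneg (by linarith) hden.le

/-- The bound `A` is arbitrary: order `T` windows of oscillation at least of order `ε` have
unbounded total. -/
lemma eventually_variation_lower_bound {Uk Vk : ℕ → ℝ → ℝ} {f g : ℝ → ℝ} {uLk uRk : ℕ → ℝ}
    {uL uR : ℝ} (hL : Tendsto uLk atTop (𝓝 uL)) (hR : Tendsto uRk atTop (𝓝 uR))
    (hg : Differentiable ℝ g) (hm : Monotone g ∨ Antitone g) (hne : g uL ≠ g uR)
    (hUk : ∀ᶠ k in atTop, Even k → IsScalarProfile f (speed k) (uLk k) (uRk k) (Uk k) ∧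
      Continuous (Uk k) ∧ ∀ u, deriv g u ≠ 0 → u ∈ Uk k '' Set.Icc (-(1 / 100)) (1 / 100))
    (hVk : ∀ᶠ k in atTop, Even k → Continuous (Vk k) ∧ Tendsto (Vk k) atTop (𝓝 0) ∧
      BoundedVariationOn (Vk k) Set.univ ∧
      LaxFriedrichsWave (speed k) (Vk k) (fun x => g (Uk k x)))
    {δ : ℝ} (hδ0 : 0 < δ) (hδ : δ < 1 / 2) (A : ℝ) :
    ∀ᶠ k in atTop, Even k → ENNReal.ofReal A ≤ eVariationOn (Vk k) (downstream δ 1 2 k) := by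
  obtain ⟨ε₀, hε₀, H⟩ := exists_variation_lower_bound
  have hM : 0 < |g uL - g uR| := abs_pos.2 (sub_ne_zero.2 hne)
  have hlim : Tendsto (fun k => |g (uLk k) - g (uRk k)|) atTop (𝓝 |g uL - g uR|) :=
    (((hg.continuous.tendsto uL).comp hL).sub ((hg.continuous.tendsto uR).comp hR)).abs
  have hgrow : Tendsto (fun k => speedGap k ^ (-2 / (1 + 2 * δ)) * speedGap k / 2 - 1) atTop
      atTop :=
    tendsto_atTop_add_const_right _ _
      ((tendsto_mul_rpow_speedGap hδ0 hδ).atTop_div_const two_pos)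
  set c : ℝ := |g uL - g uR| / 2 * (3 / 100) * Real.exp (-40000) with hc
  have hc0 : 0 < c := by positivity
  filter_upwards [hUk, hVk, hlim.eventually_const_le (half_lt_self hM),
    (hgrow.atTop_mul_const hc0).eventually_ge_atTop (max A 0), tendsto_speedGap.eventually_lt_const hε₀,
    tendsto_speedGap.eventually_le_const zero_lt_one, tendsto_speed.eventually_const_lt
      (show (0 : ℝ) < 1 / 2 by norm_num), tendsto_speed.eventually_lt_const
      (show (1 / 2 : ℝ) < 1 by norm_num)] with k hU hV hgk hA hk1 hk2 hs0 hs1 hev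
  obtain ⟨hUp, hUc, hsupp⟩ := hU hev
  obtain ⟨hVc, hVt, hbv, hw⟩ := hV hev
  have tL : Tendsto (fun x => g (Uk k x)) atBot (𝓝 (g (uLk k))) :=
    (hg.continuous.tendsto _).comp hUp.left
  have tR : Tendsto (fun x => g (Uk k x)) atTop (𝓝 (g (uRk k))) :=
    (hg.continuous.tendsto _).comp hUp.right
  obtain ⟨hT1, hT2⟩ := rpow_speedGap_bounds hδ0 k
  refine le_trans (ENNReal.ofReal_le_ofReal ?_) (H (speed k) hs0 hs1 hk1 hk2 (Vk k) _ hVc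
    (hg.continuous.comp hUc) hw hVt hbv (g (uLk k)) (g (uRk k))
    (fun x => comp_eq_left_of_deriv_supported hg hUp.strict hsupp hUp.left)
    (fun x => comp_eq_right_of_deriv_supported hg hUp.strict hsupp hUp.right)
    (abs_sub_le_of_monotone_or_antitone (comp_monotone_or_antitone hm hUp.strict) tL tR)
    (speedGap k ^ (-2 / (1 + 2 * δ))) hT1 hT2)
  change A ≤ (speedGap k ^ (-2 / (1 + 2 * δ)) / 2 - 1) *
    (speedGap k * |g (uLk k) - g (uRk k)| * (3 / 100) * Real.exp (-40000))
  set T := speedGap k ^ (-2 / (1 + 2 * δ)) with hT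
  set ε := speedGap k with hε
  set c' : ℝ := |g (uLk k) - g (uRk k)| * (3 / 100) * Real.exp (-40000) with hc'
  have hcc : c ≤ c' := by rw [hc, hc']; gcongr
  have hpos : 0 ≤ T * ε / 2 - 1 := by
    by_contra hcon
    exact absurd ((le_max_right A 0).trans hA) (not_le.2 (mul_neg_of_neg_of_pos (not_le.1 hcon) hc0))
  calc A ≤ (T * ε / 2 - 1) * c := (le_max_left A 0).trans hA
    _ ≤ (T * ε / 2 - 1) * c' := mul_le_mul_of_nonneg_left hcc hpos
    _ ≤ (T * ε / 2 - ε) * c' := mul_le_mul_of_nonneg_right (by linarith) (hc0.le.trans hcc)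
    _ = _ := by rw [hc']; ring

theorem mainTheorem1
    (f : ℝ → ℝ) (hf : ContDiff ℝ 1 f)
    (hf_hyp : ∀ u, 1 / 4 < deriv f u) (hf_cfl : ∀ u, |deriv f u| < 1)
    (uL uR : ℝ) (hshock : IsStrictShock f (1 / 2) uL uR)
    (u₀ : ℝ) (hu₀ : u₀ ∈ Set.uIoo uL uR) :
    ∃ (uLk uRk : ℕ → ℝ) (U : ℝ → ℝ) (Uk : ℕ → ℝ → ℝ) (L : NNReal) (ρ : ℝ),
      Tendsto uLk atTop (𝓝 uL) ∧ Tendsto uRk atTop (𝓝 uR) ∧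
      -- scalar profiles, all centred at the value `u₀`
      (IsScalarProfile f (1 / 2) uL uR U ∧ LipschitzWith L U ∧ U 0 = u₀) ∧
      (∀ᶠ k in atTop, Even k →
        IsScalarProfile f (speed k) (uLk k) (uRk k) (Uk k) ∧
          LipschitzWith L (Uk k) ∧ Uk k 0 = u₀) ∧
      0 < ρ ∧
      -- every flux `g` for which `(g ∘ U)'` has one sign and lives on `[-ρ, ρ]`
      ∀ g : ℝ → ℝ, ContDiff ℝ 1 g → (Monotone g ∨ Antitone g) → (∃ u, deriv g u ≠ 0) →
        (∀ u, deriv g u ≠ 0 → u ∈ U '' Set.Icc (-ρ) ρ) →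
        ∃ (V : ℝ → ℝ) (Vk : ℕ → ℝ → ℝ),
          IsSystemProfile f g (1 / 2)
            (uL, (g uL - g uR) / (1 / 2)) (uR, 0) (fun x => (U x, V x)) ∧
          (∀ᶠ k in atTop, Even k →
            IsSystemProfile f g (speed k)
              (uLk k, (g (uLk k) - g (uRk k)) / speed k) (uRk k, 0)
              (fun x => (Uk k x, Vk k x))) ∧
          -- the total variation of the difference of the profiles is bounded below
          (∃ m : ℝ, 0 < m ∧ ∀ᶠ k in atTop, Even k →
            ENNReal.ofReal m ≤
              eVariationOn (fun x => ((Uk k x, Vk k x) : ℝ × ℝ) - (U x, V x)) Set.univ) ∧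
          -- and this variation is located, in the second component, far downstream
          (∀ δ : ℝ, 0 < δ → δ < 1 / 2 → ∃ c C m : ℝ, 0 < c ∧ c < C ∧ 0 < m ∧
            ∀ᶠ k in atTop, Even k →
              ENNReal.ofReal m ≤
                eVariationOn (fun x => Vk k x - V x) (downstream δ c C k)) := by
  obtain ⟨uLk, uRk, U, Uk, L, ρ, hL, hR, ⟨hU, hUL, hU0⟩, hUk, hρ⟩ :=
    hasScalarProfiles hf hf_cfl hshock hu₀
  refine ⟨uLk, uRk, U, Uk, L, ρ, hL, hR, ⟨hU, hUL, hU0⟩,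
    hUk.mono fun k hk _ => ⟨hk.1, hk.2.1, hk.2.2.1⟩, hρ, fun g hg hm hnc hsupp => ?_⟩
  have hgd : Differentiable ℝ g := hg.differentiable one_ne_zero
  -- Speed `1/2` is `1 - l / q` with `q = 2`, `l = 1`, and `4` is coprime to `1`.
  obtain ⟨V, -, -, hVbv, hV⟩ := hU.exists_system hUL.continuous hg.continuous hm
    (q := 2) (l := 1) one_lt_two (by norm_num) (by norm_num)
  have hne : g uL ≠ g uR := by
    obtain ⟨u, hu⟩ := hnc
    obtain ⟨z, -, rfl⟩ := hsupp u hu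
    exact limits_ne_of_deriv_ne_zero hgd hm hUL.continuous hU.strict hU.left hU.right hu
  have hex : ∀ k, ∃ W : ℝ → ℝ, IsScalarProfile f (speed k) (uLk k) (uRk k) (Uk k) →
      Continuous (Uk k) → Even k → 0 < k → Continuous W ∧ Tendsto W atTop (𝓝 0) ∧
        BoundedVariationOn W Set.univ ∧ IsSystemProfile f g (speed k)
          (uLk k, (g (uLk k) - g (uRk k)) / speed k) (uRk k, 0) (fun x => (Uk k x, W x)) := by
    intro k
    by_cases h : IsScalarProfile f (speed k) (uLk k) (uRk k) (Uk k) ∧ Continuous (Uk k) ∧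
        Even k ∧ 0 < k
    · obtain ⟨W, hW⟩ := h.1.exists_system_speed h.2.1 hg.continuous hm h.2.2.1 h.2.2.2
      exact ⟨W, fun _ _ _ _ => hW⟩
    · exact ⟨0, fun h1 h2 h3 h4 => absurd ⟨h1, h2, h3, h4⟩ h⟩
  choose Vk hVk using hex
  have hVk' : ∀ᶠ k in atTop, Even k → Continuous (Vk k) ∧ Tendsto (Vk k) atTop (𝓝 0) ∧
      BoundedVariationOn (Vk k) Set.univ ∧ IsSystemProfile f g (speed k)
        (uLk k, (g (uLk k) - g (uRk k)) / speed k) (uRk k, 0) (fun x => (Uk k x, Vk k x)) := by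
    filter_upwards [hUk, eventually_gt_atTop 0] with k hk hk0 hev
    exact hVk k hk.1 hk.2.1.continuous hev hk0
  have hdown : ∀ δ : ℝ, 0 < δ → δ < 1 / 2 → ∀ᶠ k in atTop, Even k →
      ENNReal.ofReal 1 ≤ eVariationOn (fun x => Vk k x - V x) (downstream δ 1 2 k) := by
    intro δ hδ0 hδ
    -- Asking for `1` plus the total variation of `V` leaves `1` for the difference, by the triangle
    -- inequality.
    filter_upwards [eventually_variation_lower_bound (f := f) hL hR hgd hm hne
      (hUk.mono fun k hk _ => ⟨hk.1, hk.2.1.continuous, fun u hu => hk.2.2.2 (hsupp u hu)⟩)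
      (hVk'.mono fun k hk hev => ⟨(hk hev).1, (hk hev).2.1, (hk hev).2.2.1,
        (hk hev).2.2.2.wave_snd⟩) hδ0 hδ (1 + (eVariationOn V Set.univ).toReal)] with k hk hev
    have h := (hk hev).trans ((eVariationOn_le_sub_add (Vk k) V _).trans
      (add_le_add le_rfl (eVariationOn.mono V (Set.subset_univ _))))
    rw [ENNReal.ofReal_add zero_le_one ENNReal.toReal_nonneg, ENNReal.ofReal_toReal hVbv] at h
    exact (ENNReal.add_le_add_iff_right hVbv).1 h
  refine ⟨V, Vk, hV, hVk'.mono fun k hk hev => (hk hev).2.2.2, ⟨1, one_pos, ?_⟩,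
    fun δ hδ0 hδ => ⟨1, 2, 1, one_pos, one_lt_two, one_pos, hdown δ hδ0 hδ⟩⟩
  filter_upwards [hdown (1 / 4) (by norm_num) (by norm_num)] with k hk hev
  exact (hk hev).trans ((eVariationOn.mono _ (Set.subset_univ _)).trans
    (eVariationOn_snd_le (fun x => ((Uk k x, Vk k x) : ℝ × ℝ) - (U x, V x)) Set.univ))
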